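/- Let $V=\mathbb Z_{\ge 0}\times\mathbb Z$ and let $A=\{(\boldsymbol x;d): \boldsymbol x\in V,\ d\in\{0,1,2,3\}\}$ be the set of arcs: $(\boldsymbol x;d)$ has terminus $t=\boldsymbol x$, and its origin $o$ is $\boldsymbol x+(1,0)$ for $d=0$, $\boldsymbol x-(1,0)$ for $d=1$ (but $\boldsymbol x$ itself if $\boldsymbol x=(0,y)$, so that $a_y=((0,y);1)$ is a self-loop), $\boldsymbol x+(0,1)$ for $d=2$, and $\boldsymbol x-(0,1)$ for $d=3$. Write $\bar a$ for the inverse of the arc $a$, with $\bar a=a$ for a self-loop. For $\alpha,\beta\in[0,2\pi)$ let the coin $C_{\boldsymbol x}$ at $\boldsymbol x$ be $$\begin{aligned}C_{\boldsymbol x}\delta_{(\boldsymbol x;0)}&=\cos\beta\,\delta_{(\boldsymbol x;3)}+\sin\beta\,\delta_{(\boldsymbol x;2)}, & C_{\boldsymbol x}\delta_{(\boldsymbol x;1)}&=-\sin\beta\,\delta_{(\boldsymbol x;3)}+\cos\beta\,\delta_{(\boldsymbol x;2)},\\ C_{\boldsymbol x}\delta_{(\boldsymbol x;2)}&=\cos\alpha\,\delta_{(\boldsymbol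 x;1)}+\sin\alpha\,\delta_{(\boldsymbol x;0)}, & C_{\boldsymbol x}\delta_{(\boldsymbol x;3)}&=-\sin\alpha\,\delta_{(\boldsymbol x;1)}+\cos\alpha\,\delta_{(\boldsymbol x;0)},\end{aligned}$$ and let $U$ act on $\ell^2(A)$ by $(U\psi)(a)=\sum_{b:\,t(b)=o(a)}\langle\delta_{\bar a},C_{o(a)}\delta_b\rangle\,\psi(b)$. Put $\psi_0=\delta_{a_0}$ and $\nu_n(j)=|(U^{2n}\psi_0)(a_j)|^2$ for $n\ge 0$, $j\in\mathbb Z$. Let $\mathsf H(x)=1$ for $x\ge 0$ and $\mathsf H(x)=0$ for $x<0$. Linear spreading with limit function $F:[0,\infty)\to[0,1]$ means that $F$ is non-decreasing, $F\ne 0$, $F\neq c_0\mathsf H$ for every $c_0\neq 0$, and $\sum_{|j|<ny}\nu_n(j)\to F(y)$ as $n\to\infty$ at every $y\ge 0$ at which $F$ is continuous. Continuously-linear spreading occurs if such an $F$ exists that is continuous on $[0,\infty)$; ballistic spreading occurs if this holds with $F(y)=c_0\mathsf H(y-1)$ for some constant $c_0$. Localization occurs if $\limsup_{T\to\infty}\frac1T\sum_{n=0}^{T-1}\nu_n(j)>0$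 for some $j\in\mathbb Z$. For $0<p<1$ let $$f_K(x;p)=\frac{\sqrt{1-p^2}}{\pi(1-x^2)\sqrt{p^2-x^2}}\,\mathbf 1_{(-p,p)}(x).$$ **Theorem.** Let $s=\sin(\alpha+\beta)\ne 0$ and $r=\sin(\alpha-\beta)$. 1. If $0<|r|<1$, then continuously-linear spreading occurs, and for all real $a<b$ $$\lim_{n\to\infty}\sum_{a\le j/n\le b}\nu_n(j)=\int_a^b g(y)\,dy,$$ where $g$ is the integrable function $$g(y)=\frac{2s^2}{r^2}\,y^2 f_K(y;|r|)\times\begin{cases}\mathbf 1_{[0,\infty)}(y)& sr>0,\\ \mathbf 1_{(-\infty,0]}(y)& sr<0.\end{cases}$$ 2. If $|r|=1$, then ballistic spreading occurs, and for every $y\in\mathbb R$ $$\lim_{n\to\infty}\sum_{j/n\le y}\nu_n(j)=s^2\,\mathsf H(y-\operatorname{sgn}(rs)),$$ the right side being the distribution function of the point measure $s^2\delta_{\operatorname{sgn}(rs)}$. Moreover, for every $j\in\mathbb Z$, $\lim_{n\to\infty}\nu_n(\operatorname{sgn}(rs)(n-j))$ equals $s^2$ if $j=0$ and $0$ otherwise.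 3. If $r=0$, then localization occurs, and for every $j\in\mathbb Z$ $$\lim_{n\to\infty}\nu_{2n}(j)=\begin{cases}\dfrac{s^2}{\pi^2}\dfrac{4}{(j^2-1)^2}& j\text{ even},\\ 0&\text{otherwise,}\end{cases}\qquad \lim_{n\to\infty}\nu_{2n+1}(j)=\begin{cases}\dfrac{s^2}{4}& j\in\{1,-1\},\\ 0&\text{otherwise.}\end{cases}$$ -/

import Mathlib

open MeasureTheory Filter Topology
open scoped NNReal ENNReal

noncomputable section

namespace AEWalk

/-- The vertices of the half plane `ℤ₊ × ℤ`. -/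
abbrev Vertex : Type := ℕ × ℤ

/-- The arcs `(x; d)`: the arc with terminus `x` that comes from the direction labelled `d`. -/
abbrev Arc : Type := Vertex × Fin 4

/-- The terminus of an arc. -/
def terminus (a : Arc) : Vertex := a.1

/-- The origin of an arc; `((0, y); 1)` is a self-loop. -/
def origin : Arc → Vertex
  | ((x, y), 0) => (x + 1, y)
  | ((0, y), 1) => (0, y)
  | ((x + 1, y), 1) => (x, y)
  | ((x, y), 2) => (x, y + 1)
  | ((x, y), 3) => (x, y - 1)

/-- The inverse arc; a self-loop is its own inverse. -/
def arcInv : Arc → Arc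
  | ((x, y), 0) => ((x + 1, y), 1)
  | ((0, y), 1) => ((0, y), 1)
  | ((x + 1, y), 1) => ((x, y), 0)
  | ((x, y), 2) => ((x, y + 1), 3)
  | ((x, y), 3) => ((x, y - 1), 2)

theorem terminus_arcInv (a : Arc) : terminus (arcInv a) = origin a := by
  obtain ⟨⟨x, y⟩, d⟩ := a
  fin_cases d <;> cases x <;> rfl

theorem arcInv_arcInv (a : Arc) : arcInv (arcInv a) = a := by
  obtain ⟨⟨x, y⟩, d⟩ := a
  fin_cases d <;> cases x <;> simp [arcInv]

theorem origin_arcInv (a : Arc) : origin (arcInv a) = terminus a := by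
  rw [← terminus_arcInv, arcInv_arcInv]

/-- The local coin: `coin α β e d` is `⟨δ_(x;e), C_x δ_(x;d)⟩`, the same for every vertex `x`. -/
def coin (α β : ℝ) : Matrix (Fin 4) (Fin 4) ℝ :=
  !![0, 0, Real.sin α, Real.cos α;
     0, 0, Real.cos α, -Real.sin α;
     Real.sin β, Real.cos β, 0, 0;
     Real.cos β, -Real.sin β, 0, 0]

theorem abs_coin_le (α β : ℝ) (e d : Fin 4) : |coin α β e d| ≤ 1 := by
  fin_cases e <;> fin_cases d <;>
    simp [coin, Real.abs_sin_le_one, Real.abs_cos_le_one]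

/-- The Hilbert space `ℓ²(A)`. -/
abbrev State : Type := lp (fun _ : Arc => ℂ) 2

/-- `(U ψ)(a) = ∑_{b : t(b) = o(a)} ⟨δ_ā, C_{o(a)} δ_b⟩ ψ(b)`; the arcs `b` with `t(b) = o(a)` are
the four arcs `(o(a); d)`. -/
def stepFun (α β : ℝ) (ψ : Arc → ℂ) (a : Arc) : ℂ :=
  ∑ d : Fin 4, (coin α β (arcInv a).2 d : ℂ) * ψ (origin a, d)

theorem memℓp_stepFun (α β : ℝ) {ψ : Arc → ℂ} (h : Memℓp ψ 2) : Memℓp (stepFun α β ψ) 2 := by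
  have h2 : (0 : ℝ) < (2 : ℝ≥0∞).toReal := by norm_num
  have hs := (memℓp_gen_iff h2).1 h
  refine Memℓp.finsetSum (f := fun d a => (coin α β (arcInv a).2 d : ℂ) * ψ (origin a, d))
    Finset.univ fun d _ => ?_
  refine memℓp_gen ?_
  have key : Summable fun a : Arc => ‖ψ (a.1, d)‖ ^ (2 : ℝ≥0∞).toReal := by
    have hd : Summable fun x : Vertex => ‖ψ (x, d)‖ ^ (2 : ℝ≥0∞).toReal :=
      hs.comp_injective (i := fun x : Vertex => (x, d)) fun x y hxy => (Prod.ext_iff.1 hxy).1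
    refine (summable_prod_of_nonneg fun a => by positivity).2 ⟨fun x => Summable.of_finite, ?_⟩
    simpa [tsum_fintype] using hd.mul_left 4
  have key' := (Function.Involutive.toPerm arcInv arcInv_arcInv).summable_iff.2 key
  refine Summable.of_nonneg_of_le (fun a => by positivity) (fun a => ?_) key'
  have e : (((Function.Involutive.toPerm arcInv arcInv_arcInv) a).1 : Vertex) = origin a :=
    terminus_arcInv a
  simp only [Function.comp_apply, e]
  refine Real.rpow_le_rpow (norm_nonneg _) ?_ h2.le
  rw [norm_mul, Complex.norm_real]
  exact mul_le_of_le_one_left (norm_nonneg _) (abs_coin_le _ _ _ _)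

/-- The one-step time evolution `U` on `ℓ²(A)`. -/
def U (α β : ℝ) : State →ₗ[ℂ] State where
  toFun ψ := ⟨stepFun α β ψ, memℓp_stepFun α β (lp.memℓp ψ)⟩
  map_add' φ ψ := by
    ext a
    change stepFun α β (⇑φ + ⇑ψ) a = stepFun α β φ a + stepFun α β ψ a
    simp [stepFun, mul_add, Finset.sum_add_distrib]
  map_smul' c ψ := by
    ext a
    simp [stepFun, Finset.mul_sum, mul_left_comm]

/-- The self-loop at the boundary vertex `(0, j)`. -/
def selfLoop (j : ℤ) : Arc := ((0, j), 1)

/-- The initial state: the unit mass on the self-loop at the origin. -/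
def initialState : State := lp.single 2 (selfLoop 0) 1

/-- `ν_n(j)`: the probability of finding the walker on the self-loop at `(0, j)` at time `2n`. -/
def boundaryProb (α β : ℝ) (n : ℕ) (j : ℤ) : ℝ :=
  ‖((U α β ^ (2 * n)) initialState : State) (selfLoop j)‖ ^ 2

/-- All the sums over subsets of `ℤ` below converge. -/
theorem summable_boundaryProb (α β : ℝ) (n : ℕ) : Summable (boundaryProb α β n) := by
  have h2 : (0 : ℝ) < (2 : ℝ≥0∞).toReal := by norm_num
  have h := (memℓp_gen_iff h2).1 (lp.memℓp ((U α β ^ (2 * n)) initialState))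
  have h' := h.comp_injective (i := selfLoop) fun i j hij => by
    simpa [selfLoop] using hij
  refine h'.congr fun j => ?_
  simp [boundaryProb]

/-- The unit step function. -/
def unitStep (x : ℝ) : ℝ := if 0 ≤ x then 1 else 0

/-- The boundary distributions `ν` spread linearly with limit function `F : [0, ∞) → [0, 1]`:
`F` is non-decreasing, not identically zero, not a non-zero multiple of the unit step function, and
`∑_{|j| < n y} ν_n(j) → F(y)` at every `y ≥ 0` at which `F` is continuous. -/
structure LinearSpreadingWith (ν : ℕ → ℤ → ℝ) (F : ℝ≥0 → ℝ) : Prop where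
  mem_Icc : ∀ y, F y ∈ Set.Icc (0 : ℝ) 1
  monotone : Monotone F
  ne_zero : F ≠ 0
  ne_step : ∀ c : ℝ, c ≠ 0 → F ≠ fun y : ℝ≥0 => c * unitStep (y : ℝ)
  tendsto : ∀ y, ContinuousAt F y →
    Tendsto (fun n : ℕ => ∑' j : {j : ℤ // |(j : ℝ)| < n * y}, ν n j) atTop (𝓝 (F y))

/-- Continuously-linear spreading at the boundary. -/
def ContinuouslyLinearSpreading (ν : ℕ → ℤ → ℝ) : Prop :=
  ∃ F : ℝ≥0 → ℝ, LinearSpreadingWith ν F ∧ Continuous F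

/-- Ballistic spreading at the boundary. -/
def BallisticSpreading (ν : ℕ → ℤ → ℝ) : Prop :=
  ∃ c : ℝ, LinearSpreadingWith ν fun y : ℝ≥0 => c * unitStep ((y : ℝ) - 1)

/-- Localization at the boundary. -/
def Localization (ν : ℕ → ℤ → ℝ) : Prop :=
  ∃ j : ℤ, 0 < limsup (fun T : ℕ => (1 / (T : ℝ)) * ∑ n ∈ Finset.range T, ν n j) atTop

/-- The Konno function `f_K(x; p)`. -/
def konno (x p : ℝ) : ℝ :=
  Set.indicator (Set.Ioo (-p) p)
    (fun x => Real.sqrt (1 - p ^ 2) / (Real.pi * (1 - x ^ 2) * Real.sqrt (p ^ 2 - x ^ 2))) x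

/-- The limit density `g` for given `s` and `r`. -/
def limitDensity (s r y : ℝ) : ℝ :=
  2 * s ^ 2 / r ^ 2 * y ^ 2 * konno y |r| *
    (if 0 < s * r then Set.indicator (Set.Ici 0) 1 y
      else if s * r < 0 then Set.indicator (Set.Iic 0) 1 y
      else 0)

end AEWalk

end

namespace AEWalk

/-! `U` exchanges horizontal and vertical arcs, so `U ^ 2` preserves the horizontal ones. A Fourier
transform in the vertical coordinate splits it into quantum walks on the half line, one for each
momentum k, with a coin (a, b, c, d) in SU(2) and a reflecting end. The boundary amplitude depends
on the coin only through b = -(e + iv) and c = e - iv, where e = s cos k and v = r sin k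
(`boundaryFourier_exists_coin`, `halfLine_generating`).

The generating function of this amplitude is (2cX - (1 - X²) - Q) / (2(X² - 2ivX - 1)) with Q² = (1
- X²)² + 4(e² + v²)X². The denominator vanishes at iv ± √(1 - v²), on the unit circle. Q is a
product of four binomial series √(1 - zX) with |z| = 1, so its coefficients are absolutely summable,
and its values on the circle have non-negative real part (`exists_sqrt_discriminant`). At a zero t
of the denominator Q = ±2et, and the real part decides the sign: one zero is cancelled by the
numerator, the other one, τ = `edgePole`, survives. The amplitude is therefore asymptotic to
w·conj(τ)^n with w = |e| / √(1 - v²), the contribution of an edge state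
(`tendsto_halfLine_sub_edge`).

All these functions of k are bounded by 1, so the approximation holds in L¹(dk). Two consequences
carry the theorem. Amplitudes at arbitrary, possibly moving, sites are asymptotically Fourier
coefficients of the edge part (`tendsto_coeff_sub_edge`). The characteristic function of the
measures `ν n` rescaled by 1/n is an overlap of the Fourier transform with its shift by t/n, and it
tends to (1/2π)∫ w² exp(itV) dk, where V is the group velocity, the derivative of the phase of
conj(τ) (`tendsto_tsum_boundaryProb_mul_exp`).

If 0 < |r| < 1, the substitution y = V(k) turns this limit into the Fourier transform of the density
g, and Lévy's continuity theorem with the portmanteau theorem concludes. If |r| = 1, the edge part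
is a single Fourier mode, so one site moving at speed 1 carries all the limiting mass. If r = 0,
then τ = ±1 almost everywhere: the edge state stands still, and its Fourier coefficients are those
of |s cos k| and -s cos k alternately. -/

/-! ### Reduction to quantum walks on the half line. -/

/-- The amplitudes `(L n x, R n x)` of the left and right movers of the quantum walk on the half
line with coin entries `a, b, c, d` that starts from a right mover at the reflecting end. -/
def halfLine {K : Type*} [CommRing K] (a b c d : K) : ℕ → ℕ → K × K
  | 0, 0 => (0, 1)
  | 0, _ + 1 => (0, 0)
  | n + 1, 0 =>
    (a * (halfLine a b c d n 1).1 + b * (halfLine a b c d n 1).2,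
      a * (halfLine a b c d n 0).1 + b * (halfLine a b c d n 0).2)
  | n + 1, x + 1 =>
    (a * (halfLine a b c d n (x + 2)).1 + b * (halfLine a b c d n (x + 2)).2,
      c * (halfLine a b c d n x).1 + d * (halfLine a b c d n x).2)

/-- The recursion uses only ring operations. This permits evaluating the walk over Laurent
polynomials at a point of the unit circle. -/
theorem halfLine_map {K K' : Type*} [CommRing K] [CommRing K'] (f : K →+* K') (a b c d : K)
    (n x : ℕ) :
    halfLine (f a) (f b) (f c) (f d) n x =
      (f (halfLine a b c d n x).1, f (halfLine a b c d n x).2) := by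
  induction n generalizing x with
  | zero => cases x <;> simp [halfLine]
  | succ n ih => cases x <;> simp [halfLine, ih]

section LaurentCoin

open LaurentPolynomial

/-- The entries of the coin of the two-step walk, as Laurent polynomials in the Fourier variable
dual to the vertical coordinate. -/
noncomputable def coinA (α β : ℝ) : LaurentPolynomial ℂ :=
  C (Real.cos α * Real.cos β : ℂ) * T (-1) + C (-(Real.sin α * Real.sin β) : ℂ) * T 1

noncomputable def coinB (α β : ℝ) : LaurentPolynomial ℂ :=
  C (-(Real.cos α * Real.sin β) : ℂ) * T (-1) + C (-(Real.sin α * Real.cos β) : ℂ) * T 1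

noncomputable def coinC (α β : ℝ) : LaurentPolynomial ℂ :=
  C (Real.sin α * Real.cos β : ℂ) * T (-1) + C (Real.cos α * Real.sin β : ℂ) * T 1

noncomputable def coinD (α β : ℝ) : LaurentPolynomial ℂ :=
  C (-(Real.sin α * Real.sin β) : ℂ) * T (-1) + C (Real.cos α * Real.cos β : ℂ) * T 1

theorem coeff_C_mul_T_mul (r : ℂ) (m : ℤ) (f : LaurentPolynomial ℂ) (j : ℤ) :
    (C r * T m * f).coeff j = r * f.coeff (j - m) := by
  rw [← single_eq_C_mul_T, AddMonoidAlgebra.coeff_single_mul_apply]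
  congr 2; ring

theorem coeff_two_term_mul (r r' : ℂ) (f : LaurentPolynomial ℂ) (j : ℤ) :
    ((C r * T (-1) + C r' * T 1) * f).coeff j = r * f.coeff (j + 1) + r' * f.coeff (j - 1) := by
  rw [add_mul, AddMonoidAlgebra.coeff_add, Finsupp.add_apply, coeff_C_mul_T_mul,
    coeff_C_mul_T_mul, sub_neg_eq_add]

/-- The Fourier transform in the vertical direction of the two-step walk. -/
noncomputable def laurentWalk (α β : ℝ) (n x : ℕ) : LaurentPolynomial ℂ × LaurentPolynomial ℂ :=
  halfLine (coinA α β) (coinB α β) (coinC α β) (coinD α β) n x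

theorem stepFun_zero (α β : ℝ) (ψ : Arc → ℂ) (x : ℕ) (y : ℤ) :
    stepFun α β ψ ((x, y), 0) =
      Real.cos α * ψ ((x + 1, y), 2) - Real.sin α * ψ ((x + 1, y), 3) := by
  simp [stepFun, arcInv, origin, coin, Fin.sum_univ_four, sub_eq_add_neg]

theorem stepFun_one_zero (α β : ℝ) (ψ : Arc → ℂ) (y : ℤ) :
    stepFun α β ψ ((0, y), 1) =
      Real.cos α * ψ ((0, y), 2) - Real.sin α * ψ ((0, y), 3) := by
  simp [stepFun, arcInv, origin, coin, Fin.sum_univ_four, sub_eq_add_neg]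

theorem stepFun_one_succ (α β : ℝ) (ψ : Arc → ℂ) (x : ℕ) (y : ℤ) :
    stepFun α β ψ ((x + 1, y), 1) =
      Real.sin α * ψ ((x, y), 2) + Real.cos α * ψ ((x, y), 3) := by
  simp [stepFun, arcInv, origin, coin, Fin.sum_univ_four]

theorem stepFun_two (α β : ℝ) (ψ : Arc → ℂ) (x : ℕ) (y : ℤ) :
    stepFun α β ψ ((x, y), 2) =
      Real.cos β * ψ ((x, y + 1), 0) - Real.sin β * ψ ((x, y + 1), 1) := by
  simp [stepFun, arcInv, origin, coin, Fin.sum_univ_four, sub_eq_add_neg]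

theorem stepFun_three (α β : ℝ) (ψ : Arc → ℂ) (x : ℕ) (y : ℤ) :
    stepFun α β ψ ((x, y), 3) =
      Real.sin β * ψ ((x, y - 1), 0) + Real.cos β * ψ ((x, y - 1), 1) := by
  simp [stepFun, arcInv, origin, coin, Fin.sum_univ_four]

theorem U_pow_two_mul_succ_apply (α β : ℝ) (n : ℕ) (a : Arc) :
    ((U α β ^ (2 * (n + 1))) initialState : State) a =
      stepFun α β (stepFun α β ((U α β ^ (2 * n)) initialState : State)) a := by
  rw [show 2 * (n + 1) = (2 * n + 1) + 1 by ring, pow_succ', pow_succ']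
  rfl

/-- In two steps a horizontal arc passes through a vertical one, which shifts y by ±1; this is the
factor `T 1` or `T (-1)` in each coin entry. The self-loop turns the left-going output at x = 0 into
the right mover there. -/
theorem U_pow_two_mul_eq_coeff (α β : ℝ) (n x : ℕ) (y : ℤ) :
    ((U α β ^ (2 * n)) initialState : State) ((x, y), 0) = (laurentWalk α β n x).1.coeff y ∧
    ((U α β ^ (2 * n)) initialState : State) ((x, y), 1) = (laurentWalk α β n x).2.coeff y := by
  induction n generalizing x y with
  | zero =>
    have h : ∀ a : Arc, ((U α β ^ (2 * 0)) initialState : State) a =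
        if a = selfLoop 0 then 1 else 0 := by
      intro a
      simp [initialState, lp.single_apply, Pi.single_apply]
    rw [h, h]
    have e1 : (1 : LaurentPolynomial ℂ) = T 0 := T_zero.symm
    cases x <;> simp [laurentWalk, halfLine, selfLoop, e1, -T_zero, eq_comm]
  | succ n ih =>
    rw [U_pow_two_mul_succ_apply, U_pow_two_mul_succ_apply]
    cases x with
    | zero =>
      rw [stepFun_zero, stepFun_one_zero]
      simp only [stepFun_two, stepFun_three, ih]
      simp only [laurentWalk, halfLine, coinA, coinB, AddMonoidAlgebra.coeff_add,
        Finsupp.add_apply, coeff_two_term_mul]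
      constructor <;> ring
    | succ x =>
      rw [stepFun_zero, stepFun_one_succ]
      simp only [stepFun_two, stepFun_three, ih]
      simp only [laurentWalk, halfLine, coinA, coinB, coinC, coinD, AddMonoidAlgebra.coeff_add,
        Finsupp.add_apply, coeff_two_term_mul]
      constructor <;> ring

/-- The amplitude of the walker on the self-loop at `(0, j)` at time `2n`. -/
noncomputable def boundaryPoly (α β : ℝ) (n : ℕ) : LaurentPolynomial ℂ := (laurentWalk α β n 0).2

theorem boundaryProb_eq (α β : ℝ) (n : ℕ) (j : ℤ) :
    boundaryProb α β n j = ‖(boundaryPoly α β n).coeff j‖ ^ 2 := by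
  rw [boundaryProb, selfLoop, (U_pow_two_mul_eq_coeff α β n 0 j).2, boundaryPoly]

theorem eval₂_eq_sum (w : ℂˣ) (f : LaurentPolynomial ℂ) :
    eval₂ (RingHom.id ℂ) w f = ∑ j ∈ f.coeff.support, f.coeff j * ((w ^ j : ℂˣ) : ℂ) := by
  have : eval₂ (RingHom.id ℂ) w f = f.smeval (w : ℂˣ) := by
    induction f using LaurentPolynomial.induction_on' with
    | add p q hp hq => rw [map_add, hp, hq, smeval_add]
    | C_mul_T n a => rw [eval₂_C_mul_T, ← single_eq_C_mul_T, smeval_single]; simp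
  rw [this, smeval_eq_sum]
  simp [Finsupp.sum]

end LaurentCoin

/-- The unit `e^{ik}`. -/
noncomputable def phase (k : ℝ) : ℂˣ :=
  Units.mk0 (Complex.exp (k * Complex.I)) (Complex.exp_ne_zero _)

theorem phase_zpow (k : ℝ) (j : ℤ) :
    ((phase k ^ j : ℂˣ) : ℂ) = Complex.exp (j * k * Complex.I) := by
  rw [Units.val_zpow_eq_zpow_val, phase, Units.val_mk0, ← Complex.exp_int_mul, mul_assoc]

/-- The Fourier transform `∑_j ψ_n(j) e^{ijk}` of the boundary amplitudes at time `2n`. -/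
noncomputable def boundaryFourier (α β : ℝ) (n : ℕ) (k : ℝ) : ℂ :=
  ∑ j ∈ (boundaryPoly α β n).coeff.support,
    (boundaryPoly α β n).coeff j * Complex.exp (j * k * Complex.I)

/-- At T = exp(ik) the addition formulas collapse the products of sines and cosines, and the
off-diagonal entries retain only sin(α + β) and sin(α - β). -/
theorem boundaryFourier_eq_halfLine (α β : ℝ) (n : ℕ) (k : ℝ) :
    ∃ a b c d : ℂ, boundaryFourier α β n k = (halfLine a b c d n 0).2 ∧
      a = Real.cos (α + β) * Real.cos k - Real.cos (α - β) * Real.sin k * Complex.I ∧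
      b = -(Real.sin (α + β) * Real.cos k + Real.sin (α - β) * Real.sin k * Complex.I) ∧
      c = Real.sin (α + β) * Real.cos k - Real.sin (α - β) * Real.sin k * Complex.I ∧
      d = Real.cos (α + β) * Real.cos k + Real.cos (α - β) * Real.sin k * Complex.I := by
  set ev := LaurentPolynomial.eval₂ (RingHom.id ℂ) (phase k)
  have h := halfLine_map ev (coinA α β) (coinB α β) (coinC α β) (coinD α β) n 0
  have hpos : ((phase k ^ (1 : ℤ) : ℂˣ) : ℂ) = Real.cos k + Real.sin k * Complex.I := by
    rw [phase_zpow]; simp [Complex.exp_mul_I]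
  have hneg : ((phase k ^ (-1 : ℤ) : ℂˣ) : ℂ) = Real.cos k - Real.sin k * Complex.I := by
    rw [phase_zpow]
    have := Complex.exp_mul_I (-k : ℂ)
    simp at this ⊢
    rw [this]; ring
  refine ⟨ev (coinA α β), ev (coinB α β), ev (coinC α β), ev (coinD α β), ?_, ?_, ?_, ?_, ?_⟩
  · rw [h]
    change _ = ev (boundaryPoly α β n)
    simp only [ev, eval₂_eq_sum, boundaryFourier, phase_zpow]
  all_goals
    simp only [ev, coinA, coinB, coinC, coinD, map_add, LaurentPolynomial.eval₂_C_mul_T, hpos, hneg,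
      RingHom.id_apply, Real.sin_add, Real.sin_sub, Real.cos_add, Real.cos_sub]
    push_cast
    ring


/-! ### Generating functions of the half-line walk. -/

section GeneratingFunction

open PowerSeries

/-- Away from the end the recursion is translation invariant, so its generating functions are sought
geometric in x: ratio `lam` between neighbouring sites, and `S * lam` between left and right movers.
The bulk equations give `hlam` and `hS`; the reflecting end fixes the amplitude `G`. -/
theorem halfLine_eq_coeff {a b c d : ℂ} (hdet : a * d - b * c = 1) {S G lam : PowerSeries ℂ}
    (hlam : lam * (1 - C c * X * S) = C d * X)
    (hS : S * (1 - X ^ 2) - C c * X * S ^ 2 = C b * X) (hG : (1 - S) * G = 1) (n x : ℕ) :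
    halfLine a b c d n x = (coeff n (S * lam ^ (x + 1) * G), coeff n (lam ^ x * G)) := by
  have hS0 : constantCoeff S = 0 := by simpa using congrArg constantCoeff hS
  have hlam0 : constantCoeff lam = 0 := by simpa using congrArg constantCoeff hlam
  have hG0 : constantCoeff G = 1 := by simpa [hS0] using congrArg constantCoeff hG
  have hu : (1 - C c * X * S : PowerSeries ℂ) ≠ 0 := by
    intro h
    simpa using congrArg constantCoeff h
  have hdet' : C a * C d - C b * C c = (1 : PowerSeries ℂ) := by
    rw [← map_mul, ← map_mul, ← map_sub, hdet, map_one]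
  have h1 : lam = X * (C c * (S * lam) + C d) := by linear_combination hlam
  -- After clearing the denominator of `lam`, this is the quadratic equation `hS`, because the
  -- determinant is 1.
  have h2 : S = X * (C a * (S * lam) + C b) := by
    apply mul_right_cancel₀ hu
    linear_combination hS - X * C a * S * hlam - X ^ 2 * S * hdet'
  have h3 : G = 1 + S * G := by linear_combination hG
  induction n generalizing x with
  | zero =>
    cases x with
    | zero => simp [halfLine, hS0, hG0]
    | succ x => simp [halfLine, hS0, hlam0]
  | succ n ih =>
    have hL : ∀ x, S * lam ^ (x + 1) * G =
        X * (C a * (S * lam ^ (x + 2) * G) + C b * (lam ^ (x + 1) * G)) := fun x => by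
      linear_combination lam ^ (x + 1) * G * h2
    have hR : ∀ x, lam ^ (x + 1) * G =
        X * (C c * (S * lam ^ (x + 1) * G) + C d * (lam ^ x * G)) := fun x => by
      linear_combination lam ^ x * G * h1
    have hR0 : lam ^ 0 * G = 1 + X * (C a * (S * lam ^ (0 + 1) * G) + C b * (lam ^ 0 * G)) := by
      linear_combination h3 + G * h2
    cases x with
    | zero =>
      rw [hL, hR0]
      simp [halfLine, ih, coeff_succ_X_mul, coeff_one]
    | succ x =>
      rw [hL (x + 1), hR x]
      simp [halfLine, ih, coeff_succ_X_mul]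

/-- The generating function of the boundary amplitudes on the half line. -/
theorem halfLine_generating {a b c d : ℂ} (hdet : a * d - b * c = 1) (hc : c ≠ 0)
    {Q : PowerSeries ℂ} (hQ : Q ^ 2 = (1 - X ^ 2) ^ 2 - 4 * C b * C c * X ^ 2)
    (hQ0 : constantCoeff Q = 1) :
    2 * (X ^ 2 + (C b + C c) * X - 1) * PowerSeries.mk (fun n => (halfLine a b c d n 0).2) =
      2 * C c * X - (1 - X ^ 2) - Q := by
  have hc' : (C c : PowerSeries ℂ) ≠ 0 := by
    rw [Ne, map_eq_zero_iff _ C_injective]; exact hc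
  have hcc : C c⁻¹ * C c = (1 : PowerSeries ℂ) := by
    rw [← map_mul, inv_mul_cancel₀ hc, map_one]
  have h2 : C (2⁻¹ : ℂ) * 2 = (1 : PowerSeries ℂ) := by
    rw [← map_ofNat (C (R := ℂ)) 2, ← map_mul, inv_mul_cancel₀ two_ne_zero, map_one]
  -- `S` is the root of the quadratic that is a power series; the normalisation of `Q` at 0 makes
  -- the division by X possible.
  obtain ⟨S', hS'⟩ : X ∣ (1 - X ^ 2 - Q) := X_dvd_iff.2 (by simp [hQ0])
  obtain ⟨S, hSQ⟩ : ∃ S, 2 * C c * X * S = 1 - X ^ 2 - Q := by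
    refine ⟨C 2⁻¹ * C c⁻¹ * S', ?_⟩
    rw [hS']
    linear_combination X * S' * (C 2⁻¹ * 2 * hcc + h2)
  have hS : S * (1 - X ^ 2) - C c * X * S ^ 2 = C b * X := by
    have h4 : (4 * C c * X : PowerSeries ℂ) ≠ 0 := by
      rw [← map_ofNat (C (R := ℂ)) 4, ← map_mul]
      exact mul_ne_zero ((map_ne_zero_iff _ C_injective).2 (by simpa using hc)) X_ne_zero
    apply mul_left_cancel₀ h4
    linear_combination -hQ + (1 - X ^ 2 + Q - 2 * C c * X * S) * hSQ
  have hS0 : constantCoeff S = 0 := by simpa using congrArg constantCoeff hS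
  have hG : (1 - S) * (1 - S)⁻¹ = 1 := PowerSeries.mul_inv_cancel _ (by simp [hS0])
  have hJ : (1 - C c * X * S) * (1 - C c * X * S)⁻¹ = 1 :=
    PowerSeries.mul_inv_cancel _ (by simp)
  have key := halfLine_eq_coeff (a := a) (b := b) (c := c) (d := d) hdet (S := S) (G := (1 - S)⁻¹)
    (lam := C d * X * (1 - C c * X * S)⁻¹) (by linear_combination C d * X * hJ) hS hG
  have hmk : PowerSeries.mk (fun n => (halfLine a b c d n 0).2) = (1 - S)⁻¹ := by
    ext n
    rw [coeff_mk, key n 0, pow_zero, one_mul]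
  rw [hmk]
  have h1S : (1 - S) ≠ 0 := left_ne_zero_of_mul_eq_one hG
  apply mul_left_cancel₀ h1S
  linear_combination 2 * (X ^ 2 + (C b + C c) * X - 1) * hG + (1 - S) * hSQ - 2 * hS

end GeneratingFunction

/-! ### Absolutely summable power series and poles on the unit circle. -/

section Abel

open PowerSeries

/-- The coefficients of the power series are absolutely summable. -/
def AbsSummable (f : PowerSeries ℂ) : Prop := Summable fun n => ‖coeff n f‖

/-- The value of a power series at a point. -/
noncomputable def value (f : PowerSeries ℂ) (t : ℂ) : ℂ := ∑' n, coeff n f * t ^ n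

variable {f g : PowerSeries ℂ} {t : ℂ}

theorem AbsSummable.add (hf : AbsSummable f) (hg : AbsSummable g) : AbsSummable (f + g) := by
  refine Summable.of_nonneg_of_le (fun n => norm_nonneg _) (fun n => ?_) (Summable.add hf hg)
  rw [map_add]
  exact norm_add_le _ _

theorem AbsSummable.neg (hf : AbsSummable f) : AbsSummable (-f) := by
  simpa [AbsSummable] using hf

theorem AbsSummable.sub (hf : AbsSummable f) (hg : AbsSummable g) : AbsSummable (f - g) := by
  rw [sub_eq_add_neg]; exact hf.add hg.neg

theorem AbsSummable.mul (hf : AbsSummable f) (hg : AbsSummable g) : AbsSummable (f * g) := by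
  simpa only [AbsSummable, coeff_mul] using
    summable_norm_sum_mul_antidiagonal_of_summable_norm hf hg

theorem absSummable_C (a : ℂ) : AbsSummable (C a) := by
  refine summable_of_ne_finset_zero (s := {0}) fun n hn => ?_
  simp [coeff_C] at hn ⊢
  simp [hn]

theorem absSummable_X : AbsSummable X := by
  refine summable_of_ne_finset_zero (s := {1}) fun n hn => ?_
  simp [coeff_X] at hn ⊢
  simp [hn]

theorem absSummable_one : AbsSummable 1 := by simpa using absSummable_C 1

theorem AbsSummable.norm_mul_pow (hf : AbsSummable f) (ht : ‖t‖ ≤ 1) :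
    Summable fun n => ‖coeff n f * t ^ n‖ := by
  refine Summable.of_nonneg_of_le (fun n => norm_nonneg _) (fun n => ?_) hf
  rw [norm_mul, norm_pow]
  exact mul_le_of_le_one_right (norm_nonneg _) (pow_le_one₀ (norm_nonneg _) ht)

theorem AbsSummable.summable (hf : AbsSummable f) (ht : ‖t‖ ≤ 1) :
    Summable fun n => coeff n f * t ^ n := (hf.norm_mul_pow ht).of_norm

theorem value_add (hf : AbsSummable f) (hg : AbsSummable g) (ht : ‖t‖ ≤ 1) :
    value (f + g) t = value f t + value g t := by
  simp only [value, map_add, add_mul]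
  exact (hf.summable ht).tsum_add (hg.summable ht)

theorem value_neg : value (-f) t = -value f t := by
  simp [value, tsum_neg]

theorem value_sub (hf : AbsSummable f) (hg : AbsSummable g) (ht : ‖t‖ ≤ 1) :
    value (f - g) t = value f t - value g t := by
  rw [sub_eq_add_neg, value_add hf hg.neg ht, value_neg, sub_eq_add_neg]

theorem value_mul (hf : AbsSummable f) (hg : AbsSummable g) (ht : ‖t‖ ≤ 1) :
    value (f * g) t = value f t * value g t := by
  rw [value, value, value,
    tsum_mul_tsum_eq_tsum_sum_antidiagonal_of_summable_norm (hf.norm_mul_pow ht)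
      (hg.norm_mul_pow ht)]
  refine tsum_congr fun n => ?_
  rw [coeff_mul, Finset.sum_mul]
  refine Finset.sum_congr rfl fun p hp => ?_
  rw [← Finset.HasAntidiagonal.mem_antidiagonal.1 hp, pow_add]
  ring

theorem value_C (a : ℂ) : value (C a) t = a := by
  rw [value, tsum_eq_single 0 fun n hn => by simp [coeff_C, hn]]
  simp

theorem value_one : value 1 t = 1 := by simpa using value_C (t := t) 1

theorem value_X : value X t = t := by
  rw [value, tsum_eq_single 1 fun n hn => by simp [coeff_X, hn]]
  simp

theorem AbsSummable.rescale (hf : AbsSummable f) {z : ℂ} (hz : ‖z‖ ≤ 1) :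
    AbsSummable (rescale z f) := by
  simpa [AbsSummable, mul_comm] using hf.norm_mul_pow hz

theorem value_rescale (z : ℂ) : value (PowerSeries.rescale z f) t = value f (z * t) := by
  simp [value, mul_pow, mul_comm, mul_assoc]

/-- Division by 1 - uX, with u = 1/t, produces partial sums of `N` at t. Absolute summability then
gives the residue even though the pole lies on the circle. -/
theorem coeff_mul_mk_pow (N : PowerSeries ℂ) {t u : ℂ} (htu : u * t = 1) (n : ℕ) :
    coeff n (N * PowerSeries.mk (fun n => u ^ n)) =
      u ^ n * ∑ i ∈ Finset.range (n + 1), coeff i N * t ^ i := by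
  rw [coeff_mul, Finset.Nat.sum_antidiagonal_eq_sum_range_succ_mk, Finset.mul_sum]
  refine Finset.sum_congr rfl fun i hi => ?_
  have hi' : i ≤ n := Nat.lt_succ_iff.1 (Finset.mem_range.1 hi)
  obtain ⟨m, rfl⟩ := Nat.exists_eq_add_of_le hi'
  simp only [coeff_mk, Nat.add_sub_cancel_left, pow_add]
  have : u ^ i * t ^ i = 1 := by rw [← mul_pow, htu, one_pow]
  linear_combination -(coeff i N * u ^ m) * this

theorem one_sub_mul_mk_pow (u : ℂ) :
    (1 - C u * X) * PowerSeries.mk (fun n => u ^ n) = 1 := by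
  ext n
  cases n with
  | zero => simp
  | succ n =>
    rw [sub_mul, one_mul, mul_assoc, map_sub, coeff_C_mul, coeff_succ_X_mul]
    simp [coeff_one, pow_succ']

/-- The coefficients of a rational-type generating function with two simple poles on the unit
circle and absolutely summable numerator. -/
theorem tendsto_coeff_sub_poles {G N : PowerSeries ℂ} {t₀ t₁ u₀ u₁ : ℂ}
    (hN : AbsSummable N) (h₀ : u₀ * t₀ = 1) (h₁ : u₁ * t₁ = 1) (ht₀ : ‖t₀‖ = 1) (ht₁ : ‖t₁‖ = 1)
    (hne : t₀ ≠ t₁) (hG : 2 * ((X - C t₀) * (X - C t₁)) * G = N) :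
    Tendsto (fun n => coeff n G -
      (u₁ ^ (n + 1) * value N t₁ - u₀ ^ (n + 1) * value N t₀) / (2 * (t₀ - t₁)))
      atTop (𝓝 0) := by
  have hd : t₀ - t₁ ≠ 0 := sub_ne_zero.2 hne
  have hu : ∀ {t u : ℂ}, u * t = 1 → ‖t‖ = 1 → ‖u‖ = 1 := fun {t u} h ht => by
    simpa [ht] using congrArg norm h
  set E : ℂ → PowerSeries ℂ := fun u => PowerSeries.mk (fun n => u ^ n)
  have hE : ∀ {t u : ℂ}, u * t = 1 → (X - C t) * (C u * E u) = -1 := fun {t u} h => by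
    have h' : C u * C t = (1 : PowerSeries ℂ) := by rw [← map_mul, h, map_one]
    linear_combination -one_sub_mul_mk_pow u - E u * h'
  -- Partial fractions for the two simple poles.
  have hGE : 2 * C (t₀ - t₁) * G = N * (C u₁ * E u₁) - N * (C u₀ * E u₀) := by
    rw [map_sub, ← hG]
    linear_combination 2 * G * (X - C t₁) * hE h₀ - 2 * G * (X - C t₀) * hE h₁
  have hcoeff : ∀ n, coeff n G =
      (u₁ ^ (n + 1) * (∑ i ∈ Finset.range (n + 1), coeff i N * t₁ ^ i) -
        u₀ ^ (n + 1) * ∑ i ∈ Finset.range (n + 1), coeff i N * t₀ ^ i) / (2 * (t₀ - t₁)) := by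
    intro n
    have h := congrArg (coeff n) hGE
    rw [← map_ofNat (C (R := ℂ)) 2, ← map_mul,
      show N * (C u₁ * E u₁) = C u₁ * (N * E u₁) by ring,
      show N * (C u₀ * E u₀) = C u₀ * (N * E u₀) by ring, map_sub, coeff_C_mul, coeff_C_mul,
      coeff_C_mul, coeff_mul_mk_pow N h₁, coeff_mul_mk_pow N h₀] at h
    rw [eq_div_iff (by simpa using hd)]
    linear_combination h
  have hlim : ∀ {t u : ℂ}, u * t = 1 → ‖t‖ = 1 → Tendsto (fun n => u ^ (n + 1) *
      ((∑ i ∈ Finset.range (n + 1), coeff i N * t ^ i) - value N t)) atTop (𝓝 0) := by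
    intro t u h ht
    have h1 := (((hN.summable ht.le).hasSum.tendsto_sum_nat).comp (tendsto_add_atTop_nat 1)).sub_const
      (value N t)
    rw [show (∑' n, coeff n N * t ^ n) = value N t from rfl, sub_self] at h1
    refine squeeze_zero_norm (fun n => ?_) (tendsto_norm_zero.comp h1)
    simp [hu h ht]
  have h := ((hlim h₁ ht₁).sub (hlim h₀ ht₀)).div_const (2 * (t₀ - t₁))
  rw [sub_zero, zero_div] at h
  refine h.congr fun n => ?_
  rw [hcoeff]
  ring

end Abel


/-! ### The binomial series of √(1 - X) on the closed disc. -/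

section SqrtSeries

open PowerSeries

/-- The binomial series of `√(1 - X)`. -/
noncomputable def sqrtSeries : PowerSeries ℂ :=
  1 - C 2⁻¹ * X * rescale 4⁻¹ (PowerSeries.map (Nat.castRingHom ℂ) catalanSeries)

/-- The Catalan equation c = 1 + Xc², rescaled by 1/4, after completing the square. -/
theorem sqrtSeries_sq : sqrtSeries ^ 2 = 1 - X := by
  have h := congrArg (rescale (4⁻¹ : ℂ)) (congrArg (PowerSeries.map (Nat.castRingHom ℂ))
    catalanSeries_sq_mul_X_add_one)
  simp only [map_add, map_mul, map_pow, map_one, PowerSeries.map_X, rescale_X] at h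
  have h2 : C (2⁻¹ : ℂ) * 2 = (1 : PowerSeries ℂ) := by
    rw [← map_ofNat (C (R := ℂ)) 2, ← map_mul, inv_mul_cancel₀ two_ne_zero, map_one]
  have h4 : C (4⁻¹ : ℂ) = (C 2⁻¹ * C 2⁻¹ : PowerSeries ℂ) := by
    rw [← map_mul]; norm_num
  rw [h4] at h
  rw [sqrtSeries]
  linear_combination X * h - X * rescale 4⁻¹ (PowerSeries.map (Nat.castRingHom ℂ) catalanSeries) * h2

theorem coeff_zero_sqrtSeries : coeff 0 sqrtSeries = 1 := by
  simp [sqrtSeries]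

theorem norm_coeff_succ_sqrtSeries (n : ℕ) :
    ‖coeff (n + 1) sqrtSeries‖ = catalan n / (2 * 4 ^ n) := by
  rw [sqrtSeries, map_sub, mul_assoc, coeff_C_mul, coeff_succ_X_mul]
  simp [coeff_one]
  ring

/-- A telescoping sum for centralBinom n / 4^n. It gives absolute summability and also the sharp
bound 1 on the non-constant part, which yields the sign of the real part. -/
theorem sum_norm_coeff_succ_sqrtSeries (n : ℕ) :
    ∑ i ∈ Finset.range n, ‖coeff (i + 1) sqrtSeries‖ = 1 - Nat.centralBinom n / 4 ^ n := by
  induction n with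
  | zero => simp
  | succ n ih =>
    have h1 : ((n + 1 : ℕ) : ℝ) * Nat.centralBinom (n + 1) =
        2 * (2 * n + 1) * Nat.centralBinom n := by
      exact_mod_cast Nat.succ_mul_centralBinom_succ n
    have h2 : ((n + 1 : ℕ) : ℝ) * catalan n = Nat.centralBinom n := by
      exact_mod_cast succ_mul_catalan_eq_centralBinom n
    have h3 : ((n + 1 : ℕ) : ℝ) ≠ 0 := by positivity
    have h4 : 4 * (Nat.centralBinom n : ℝ) - Nat.centralBinom (n + 1) = 2 * catalan n := by
      apply mul_left_cancel₀ h3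
      push_cast at h1 h2 ⊢
      linear_combination -h1 - 2 * h2
    rw [Finset.sum_range_succ, ih, norm_coeff_succ_sqrtSeries, pow_succ]
    field_simp
    linear_combination -2 * h4

theorem absSummable_sqrtSeries : AbsSummable sqrtSeries := by
  refine (summable_nat_add_iff 1).1 (summable_of_sum_range_le (c := 1) (fun _ => norm_nonneg _)
    fun n => ?_)
  rw [sum_norm_coeff_succ_sqrtSeries]
  exact sub_le_self _ (by positivity)

theorem re_value_sqrtSeries_nonneg {t : ℂ} (ht : ‖t‖ ≤ 1) : 0 ≤ (value sqrtSeries t).re := by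
  have h1 : Summable fun n => ‖coeff (n + 1) sqrtSeries‖ :=
    (summable_nat_add_iff 1).2 absSummable_sqrtSeries
  have hle : ∑' n, ‖coeff (n + 1) sqrtSeries‖ ≤ 1 := by
    refine Real.tsum_le_of_sum_range_le (fun _ => norm_nonneg _) fun n => ?_
    rw [sum_norm_coeff_succ_sqrtSeries]
    exact sub_le_self _ (by positivity)
  have hb : ∀ n, ‖coeff (n + 1) sqrtSeries * t ^ (n + 1)‖ ≤ ‖coeff (n + 1) sqrtSeries‖ := by
    intro n
    rw [norm_mul, norm_pow]
    exact mul_le_of_le_one_right (norm_nonneg _) (pow_le_one₀ (norm_nonneg _) ht)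
  have hn : ‖∑' n, coeff (n + 1) sqrtSeries * t ^ (n + 1)‖ ≤ 1 :=
    (tsum_of_norm_bounded h1.hasSum hb).trans hle
  rw [value, (absSummable_sqrtSeries.summable ht).tsum_eq_zero_add, coeff_zero_sqrtSeries]
  have := (abs_le.1 ((Complex.abs_re_le_norm _).trans hn)).1
  simp only [pow_zero, mul_one, Complex.add_re, Complex.one_re]
  linarith

theorem value_sqrtSeries_sq {t : ℂ} (ht : ‖t‖ ≤ 1) : value sqrtSeries t ^ 2 = 1 - t := by
  rw [sq, ← value_mul absSummable_sqrtSeries absSummable_sqrtSeries ht, ← sq, sqrtSeries_sq,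
    value_sub absSummable_one absSummable_X ht, value_one, value_X]

/-- A square root in the right half plane of a point of the right half plane lies in the sector
|arg| ≤ π/4. Two factors from that sector have a product in the right half plane again; these two
facts follow the branch of the square root through products. -/
theorem abs_im_le_re_of_sq {u : ℂ} (h : 0 ≤ u.re) (h2 : 0 ≤ (u ^ 2).re) : |u.im| ≤ u.re := by
  refine abs_le_of_sq_le_sq ?_ h
  simp [sq] at h2 ⊢
  linarith

theorem re_mul_nonneg {u v : ℂ} (hu : |u.im| ≤ u.re) (hv : |v.im| ≤ v.re) : 0 ≤ (u * v).re := by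
  rw [Complex.mul_re]
  have h := mul_le_mul hu hv (abs_nonneg _) ((abs_nonneg _).trans hu)
  rw [← abs_mul] at h
  linarith [le_abs_self (u.im * v.im)]

theorem re_one_sub_nonneg {t : ℂ} (ht : ‖t‖ ≤ 1) : 0 ≤ (1 - t).re := by
  have := (Complex.re_le_norm t).trans ht
  simp; linarith

theorem abs_im_value_sqrtSeries {t : ℂ} (ht : ‖t‖ ≤ 1) :
    |(value sqrtSeries t).im| ≤ (value sqrtSeries t).re :=
  abs_im_le_re_of_sq (re_value_sqrtSeries_nonneg ht)
    (by rw [value_sqrtSeries_sq ht]; exact re_one_sub_nonneg ht)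

/-- The square root of `(1 - X ^ 2) ^ 2 + 4 p ^ 2 X ^ 2` for `0 ≤ p ≤ 1`: its coefficients are
absolutely summable, and its values on the unit circle have non-negative real part. -/
theorem exists_sqrt_discriminant {p : ℝ} (hp : p ^ 2 ≤ 1) :
    ∃ Q : PowerSeries ℂ, Q ^ 2 = (1 - X ^ 2) ^ 2 + 4 * C ((p : ℂ) ^ 2) * X ^ 2 ∧
      constantCoeff Q = 1 ∧ AbsSummable Q ∧
      ∀ t : ℂ, ‖t‖ = 1 → 0 ≤ (value Q t).re := by
  -- These satisfy zz' = 1 and z² + z'² = 2 - 4p², so the discriminant is (1 - z²X²)(1 - z'²X²), and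
  -- each factor splits again into 1 ± zX.
  set z : ℂ := Real.sqrt (1 - p ^ 2) + p * Complex.I
  set z' : ℂ := Real.sqrt (1 - p ^ 2) - p * Complex.I
  have hsq : ((Real.sqrt (1 - p ^ 2) : ℝ) : ℂ) ^ 2 = 1 - p ^ 2 := by
    rw [← Complex.ofReal_pow, Real.sq_sqrt (by linarith)]
    push_cast; ring
  have hzz : z * z' = 1 := by
    linear_combination hsq - p ^ 2 * Complex.I_sq
  have hz2 : z ^ 2 + z' ^ 2 = 2 - 4 * p ^ 2 := by
    linear_combination 2 * hsq + 2 * p ^ 2 * Complex.I_sq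
  have hconj : z' = (starRingEnd ℂ) z := by
    simp [z, z', sub_eq_add_neg]
  have hz : ‖z‖ = 1 := by
    have : ‖z‖ * ‖z‖ = 1 := by
      have h := congrArg norm hzz
      rwa [hconj, norm_mul, Complex.norm_conj, norm_one] at h
    nlinarith [norm_nonneg z]
  have hz' : ‖z'‖ = 1 := by rw [hconj, Complex.norm_conj, hz]
  have hr : ∀ w : ℂ, rescale w sqrtSeries ^ 2 = 1 - C w * X := fun w => by
    rw [← map_pow, sqrtSeries_sq, map_sub, map_one, rescale_X]
  have hr0 : ∀ w : ℂ, constantCoeff (rescale w sqrtSeries) = 1 := fun w => by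
    rw [← coeff_zero_eq_constantCoeff_apply, coeff_rescale, coeff_zero_sqrtSeries]; simp
  have hsum : ∀ {w : ℂ}, ‖w‖ = 1 →
      AbsSummable (rescale w sqrtSeries * rescale (-w) sqrtSeries) := fun {w} h =>
    (absSummable_sqrtSeries.rescale h.le).mul (absSummable_sqrtSeries.rescale (by simp [h]))
  -- Pairing w with -w keeps the product in the sector |arg| ≤ π/4, since its square is 1 - (wt)². A
  -- direct estimate for all four factors would only give |arg| ≤ π.
  have hval : ∀ {w t : ℂ}, ‖w‖ = 1 → ‖t‖ = 1 →
      |(value (rescale w sqrtSeries * rescale (-w) sqrtSeries) t).im| ≤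
        (value (rescale w sqrtSeries * rescale (-w) sqrtSeries) t).re := by
    intro w t hw ht
    have h1 : ‖w * t‖ ≤ 1 := by simp [hw, ht]
    have h2 : ‖-w * t‖ ≤ 1 := by simp [hw, ht]
    rw [value_mul (absSummable_sqrtSeries.rescale hw.le)
      (absSummable_sqrtSeries.rescale (by simp [hw])) ht.le, value_rescale, value_rescale]
    refine abs_im_le_re_of_sq
      (re_mul_nonneg (abs_im_value_sqrtSeries h1) (abs_im_value_sqrtSeries h2)) ?_
    rw [mul_pow, value_sqrtSeries_sq h1, value_sqrtSeries_sq h2,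
      show (1 - w * t) * (1 - -w * t) = 1 - (w * t) ^ 2 by ring]
    exact re_one_sub_nonneg (by simp [hw, ht])
  refine ⟨(rescale z sqrtSeries * rescale (-z) sqrtSeries) *
    (rescale z' sqrtSeries * rescale (-z') sqrtSeries), ?_, ?_, (hsum hz).mul (hsum hz'), ?_⟩
  · have e1 : C z * C z' = (1 : PowerSeries ℂ) := by rw [← map_mul, hzz, map_one]
    have e2 : C z ^ 2 + C z' ^ 2 = (2 - 4 * C ((p : ℂ) ^ 2) : PowerSeries ℂ) := by
      rw [← map_pow, ← map_pow, ← map_add, hz2, map_sub, map_mul, map_ofNat, map_ofNat]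
    rw [mul_pow, mul_pow, mul_pow, hr, hr, hr, hr, map_neg, map_neg]
    linear_combination (C z * C z' + 1) * X ^ 4 * e1 - X ^ 2 * e2
  · simp [hr0]
  · intro t ht
    rw [value_mul (hsum hz) (hsum hz') ht.le]
    exact re_mul_nonneg (hval hz ht) (hval hz' ht)

end SqrtSeries

/-! ### The edge state: which pole survives. -/

/-- The pole of the boundary generating function on the unit circle, in terms of
`e = s cos k` and `v = r sin k`. -/
noncomputable def edgePole (e v : ℝ) : ℂ :=
  -(Real.sign e * Real.sqrt (1 - v ^ 2) : ℝ) + v * Complex.I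

/-- The weight of the edge state. -/
noncomputable def edgeWeight (e v : ℝ) : ℝ := |e| / Real.sqrt (1 - v ^ 2)

theorem sign_sq {e : ℝ} (he : e ≠ 0) : Real.sign e ^ 2 = 1 := by
  rcases Real.sign_apply_eq_of_ne_zero e he with h | h <;> rw [h] <;> norm_num

theorem edgePole_mul_conj {e v : ℝ} (he : e ≠ 0) (hv : v ^ 2 ≤ 1) :
    edgePole e v * (starRingEnd ℂ) (edgePole e v) = 1 := by
  rw [Complex.mul_conj, Complex.normSq_apply]
  simp only [edgePole, Complex.add_re, Complex.neg_re, Complex.ofReal_re, Complex.mul_re,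
    Complex.I_re, Complex.ofReal_im, Complex.I_im, Complex.add_im, Complex.neg_im, Complex.mul_im]
  norm_cast
  have h1 := sign_sq he
  have h2 := Real.sq_sqrt (show 0 ≤ 1 - v ^ 2 by linarith)
  linear_combination Real.sqrt (1 - v ^ 2) ^ 2 * h1 + h2

theorem norm_edgePole {e v : ℝ} (he : e ≠ 0) (hv : v ^ 2 ≤ 1) : ‖edgePole e v‖ = 1 := by
  have h := congrArg norm (edgePole_mul_conj he hv)
  rw [norm_mul, Complex.norm_conj, norm_one] at h
  nlinarith [norm_nonneg (edgePole e v)]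

open PowerSeries in
/-- The boundary amplitude on the half line is asymptotically that of the edge state. -/
theorem tendsto_halfLine_sub_edge {a b c d : ℂ} {e v : ℝ} (hdet : a * d - b * c = 1)
    (hb : b = -(e + v * Complex.I)) (hc : c = e - v * Complex.I) (he : e ≠ 0) (hv : v ^ 2 < 1)
    (hev : e ^ 2 + v ^ 2 ≤ 1) :
    Tendsto (fun n => (halfLine a b c d n 0).2 -
      edgeWeight e v * (starRingEnd ℂ) (edgePole e v) ^ n) atTop (𝓝 0) := by
  have hc0 : c ≠ 0 := by
    intro h
    have := congrArg Complex.re (hc ▸ h : (e : ℂ) - v * Complex.I = 0)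
    simp at this
    exact he this
  have hp : Real.sqrt (e ^ 2 + v ^ 2) ^ 2 = e ^ 2 + v ^ 2 := Real.sq_sqrt (by positivity)
  obtain ⟨Q, hQ, hQ0, hQs, hQre⟩ := exists_sqrt_discriminant (p := Real.sqrt (e ^ 2 + v ^ 2))
    (by rw [hp]; exact hev)
  have hbc : ((Real.sqrt (e ^ 2 + v ^ 2) : ℝ) : ℂ) ^ 2 = -(b * c) := by
    rw [← Complex.ofReal_pow, hp, hb, hc]
    push_cast
    linear_combination (v : ℂ) ^ 2 * Complex.I_sq
  rw [hbc, map_neg, map_mul] at hQ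
  have hG := halfLine_generating hdet hc0 (Q := Q) (by linear_combination hQ) hQ0
  set σ : ℝ := Real.sign e
  have hσ : σ ^ 2 = 1 := sign_sq he
  have hσe : |e| = σ * e := by
    rcases he.lt_or_gt with h | h
    · simp only [σ]; rw [abs_of_neg h, Real.sign_of_neg h]; ring
    · simp only [σ]; rw [abs_of_pos h, Real.sign_of_pos h]; ring
  set q : ℝ := Real.sqrt (1 - v ^ 2)
  have hq : 0 < q := Real.sqrt_pos.2 (by linarith)
  have hq2 : q ^ 2 = 1 - v ^ 2 := Real.sq_sqrt (by linarith)
  have hq2' : (q : ℂ) ^ 2 = 1 - v ^ 2 := by exact_mod_cast hq2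
  have hσ' : (σ : ℂ) ^ 2 = 1 := by exact_mod_cast hσ
  set t₀ : ℂ := edgePole e v
  have ht₀ : t₀ = -(σ * q) + v * Complex.I := by simp [t₀, edgePole, σ, q]
  set t₁ : ℂ := σ * q + v * Complex.I with ht₁
  have hn0 : ‖t₀‖ = 1 := norm_edgePole he hv.le
  have hconj : (starRingEnd ℂ) t₀ = -t₁ := by
    rw [ht₀, ht₁]; simp; ring
  have hn1 : ‖t₁‖ = 1 := by
    rw [← norm_neg, ← hconj, Complex.norm_conj, hn0]
  have hroot : ∀ t : ℂ, (t = t₀ ∨ t = t₁) → t ^ 2 = 1 + 2 * v * Complex.I * t := by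
    rintro t (rfl | rfl)
    · rw [ht₀]
      linear_combination (σ : ℂ) ^ 2 * hq2' + (1 - (v : ℂ) ^ 2) * hσ' - (v : ℂ) ^ 2 * Complex.I_sq
    · rw [ht₁]
      linear_combination (σ : ℂ) ^ 2 * hq2' + (1 - (v : ℂ) ^ 2) * hσ' - (v : ℂ) ^ 2 * Complex.I_sq
  -- At a root 1 - t² = -2ivt, so Q² = -4v²t² + 4(e² + v²)t².
  have hvalQ2 : ∀ t : ℂ, (t = t₀ ∨ t = t₁) → ‖t‖ = 1 → value Q t ^ 2 = (2 * e * t) ^ 2 := by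
    intro t ht hn
    have hX2 : AbsSummable (X ^ 2 : PowerSeries ℂ) := by
      rw [sq]; exact absSummable_X.mul absSummable_X
    have e1 : Q * Q = (1 - X ^ 2) * (1 - X ^ 2) + C (-4 * (b * c)) * X ^ 2 := by
      rw [map_mul, map_neg, map_ofNat, map_mul]
      linear_combination hQ
    have hv1 : value (X ^ 2) t = t ^ 2 := by
      rw [sq, value_mul absSummable_X absSummable_X hn.le, value_X, sq]
    have e2 : value (Q * Q) t = value ((1 - X ^ 2) * (1 - X ^ 2) + C (-4 * (b * c)) * X ^ 2) t := by
      rw [e1]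
    rw [value_mul hQs hQs hn.le, value_add ((absSummable_one.sub hX2).mul (absSummable_one.sub hX2))
      ((absSummable_C _).mul hX2) hn.le, value_mul (absSummable_one.sub hX2)
      (absSummable_one.sub hX2) hn.le, value_mul (absSummable_C _) hX2 hn.le,
      value_sub absSummable_one hX2 hn.le, value_one, value_C, hv1, hb, hc] at e2
    have h := hroot t ht
    linear_combination e2 + (t ^ 2 - 1 + 2 * v * Complex.I * t) * h
  -- The wrong sign would make the real part of Q(t) strictly negative.
  have hQval : ∀ (t : ℂ) (δ : ℝ), (t = t₀ ∨ t = t₁) → ‖t‖ = 1 → δ ^ 2 = 1 →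
      0 < δ * e * t.re → value Q t = δ * (2 * e * t) := by
    intro t δ ht hn hδ hpos
    have h2 : value Q t ^ 2 = (δ * (2 * e * t)) ^ 2 := by
      have hδ' : (δ : ℂ) ^ 2 = 1 := by exact_mod_cast hδ
      rw [hvalQ2 t ht hn]
      linear_combination -(2 * e * t) ^ 2 * hδ'
    rcases sq_eq_sq_iff_eq_or_eq_neg.1 h2 with h | h
    · exact h
    · exfalso
      have h3 := hQre t hn
      rw [h] at h3
      have : (-(δ * (2 * e * t)) : ℂ).re = -(2 * (δ * e * t.re)) := by
        simp; ring
      rw [this] at h3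
      linarith
  have habs : 0 < σ * e := by rw [← hσe]; exact abs_pos.2 he
  have hQ₀ : value Q t₀ = ((-1 : ℝ) : ℂ) * (2 * e * t₀) := by
    refine hQval t₀ (-1) (Or.inl rfl) hn0 (by norm_num) ?_
    have : t₀.re = -(σ * q) := by rw [ht₀]; simp
    rw [this]
    nlinarith
  have hQ₁ : value Q t₁ = ((1 : ℝ) : ℂ) * (2 * e * t₁) := by
    refine hQval t₁ 1 (Or.inr rfl) hn1 (by norm_num) ?_
    have : t₁.re = σ * q := by rw [ht₁]; simp
    rw [this]
    nlinarith
  set N : PowerSeries ℂ := 2 * C c * X - (1 - X ^ 2) - Q with hN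
  have hN' : N = C (2 * c) * X - (1 - X * X) - Q := by
    rw [hN, map_mul, map_ofNat]; ring
  have hA1 : AbsSummable (C (2 * c) * X) := (absSummable_C _).mul absSummable_X
  have hA2 : AbsSummable (1 - X * X : PowerSeries ℂ) :=
    absSummable_one.sub (absSummable_X.mul absSummable_X)
  have hNs : AbsSummable N := by
    rw [hN']; exact (hA1.sub hA2).sub hQs
  have hNval : ∀ t : ℂ, (t = t₀ ∨ t = t₁) → ‖t‖ = 1 → value N t = 2 * e * t - value Q t := by
    intro t ht hn
    rw [hN', value_sub (hA1.sub hA2) hQs hn.le, value_sub hA1 hA2 hn.le,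
      value_mul (absSummable_C _) absSummable_X hn.le,
      value_sub absSummable_one (absSummable_X.mul absSummable_X) hn.le,
      value_mul absSummable_X absSummable_X hn.le, value_one, value_X, value_C, hc]
    linear_combination hroot t ht
  have hdiff : t₀ - t₁ = -(2 * σ * q) := by rw [ht₀, ht₁]; ring
  have hσ0 : (σ : ℂ) ≠ 0 := fun h => by simp [h] at hσ'
  have hq0 : (q : ℂ) ≠ 0 := by exact_mod_cast hq.ne'
  have hne : t₀ ≠ t₁ := by
    rw [← sub_ne_zero, hdiff]
    simp [hσ0, hq0]
  have hprod : t₀ * t₁ = -1 := by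
    have := edgePole_mul_conj he hv.le
    change t₀ * (starRingEnd ℂ) t₀ = 1 at this
    rw [hconj] at this
    linear_combination -this
  have hprod' : C t₀ * C t₁ = (-1 : PowerSeries ℂ) := by
    rw [← map_mul, hprod, map_neg, map_one]
  have hsum' : C t₀ + C t₁ = -(C b + C c : PowerSeries ℂ) := by
    rw [← map_add, ← map_add, ← map_neg, ht₀, ht₁, hb, hc]
    congr 1; ring
  have key := tendsto_coeff_sub_poles (G := PowerSeries.mk fun n => (halfLine a b c d n 0).2)
    (N := N) (t₀ := t₀) (t₁ := t₁) (u₀ := -t₁) (u₁ := -t₀) hNs (by linear_combination -hprod)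
    (by linear_combination -hprod) hn0 hn1 hne (by
      rw [← hG]
      linear_combination 2 * (PowerSeries.mk fun n => (halfLine a b c d n 0).2) *
        (hprod' - X * hsum'))
  rw [hNval t₁ (Or.inr rfl) hn1, hNval t₀ (Or.inl rfl) hn0, hQ₀, hQ₁] at key
  refine key.congr fun n => ?_
  rw [coeff_mk, hconj, hdiff]
  congr 1
  have hw : ((edgeWeight e v : ℝ) : ℂ) = σ * e / q := by
    rw [edgeWeight, hσe]; push_cast; rfl
  -- The residue at t₁ vanishes, since Q(t₁) = 2et₁; at t₀ the numerator equals 4et₀.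
  have hnum : (-t₀) ^ (n + 1) * (2 * e * t₁ - ((1 : ℝ) : ℂ) * (2 * e * t₁)) -
      (-t₁) ^ (n + 1) * (2 * e * t₀ - ((-1 : ℝ) : ℂ) * (2 * e * t₀)) = -(4 * e) * (-t₁) ^ n := by
    rw [pow_succ (-t₁)]
    push_cast
    linear_combination 4 * e * (-t₁) ^ n * hprod
  rw [hnum, hw]
  generalize (-t₁) ^ n = P
  field_simp
  linear_combination -4 * e * P * hσ'


/-! ### Uniform bounds and the edge part as a function of the momentum. -/

theorem halfLine_norm_sum_le {a b c d : ℂ} (hd : d = (starRingEnd ℂ) a)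
    (hc : c = -(starRingEnd ℂ) b) (hab : Complex.normSq a + Complex.normSq b = 1) (n N : ℕ) :
    ∑ x ∈ Finset.range N, (Complex.normSq (halfLine a b c d n x).1 +
      Complex.normSq (halfLine a b c d n x).2) ≤ 1 := by
  have hU : ∀ L R : ℂ, Complex.normSq (a * L + b * R) + Complex.normSq (c * L + d * R) =
      Complex.normSq L + Complex.normSq R := by
    intro L R
    rw [hc, hd]
    rw [Complex.normSq_apply, Complex.normSq_apply] at hab
    simp only [Complex.normSq_apply, Complex.add_re, Complex.add_im, Complex.mul_re, Complex.mul_im,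
      Complex.neg_re, Complex.neg_im, Complex.conj_re, Complex.conj_im]
    linear_combination (L.re * L.re + L.im * L.im + R.re * R.re + R.im * R.im) * hab
  induction n generalizing N with
  | zero =>
    cases N with
    | zero => simp
    | succ N =>
      rw [Finset.sum_range_succ']
      simp [halfLine]
  | succ n ih =>
    -- The first N sites at time n + 1 are fed only by the first N + 1 sites at time n; the outputs
    -- that leave the window to the right are discarded.
    refine le_trans ?_ (ih (N + 1))
    rw [Finset.sum_congr rfl fun x (_ : x ∈ Finset.range (N + 1)) =>
      (hU (halfLine a b c d n x).1 (halfLine a b c d n x).2).symm]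
    cases N with
    | zero => simpa using add_nonneg (Complex.normSq_nonneg _) (Complex.normSq_nonneg _)
    | succ N =>
      rw [Finset.sum_add_distrib, Finset.sum_add_distrib, Finset.sum_range_succ' _ N,
        Finset.sum_range_succ' _ N, Finset.sum_range_succ' _ (N + 1), Finset.sum_range_succ' _ N,
        Finset.sum_range_succ _ (N + 1), Finset.sum_range_succ _ N]
      simp only [halfLine]
      have h1 := Complex.normSq_nonneg (c * (halfLine a b c d n N).1 + d * (halfLine a b c d n N).2)
      have h2 := Complex.normSq_nonneg
        (c * (halfLine a b c d n (N + 1)).1 + d * (halfLine a b c d n (N + 1)).2)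
      simp only [zero_add, add_assoc, Nat.reduceAdd]
      linarith

theorem boundaryFourier_exists_coin (α β : ℝ) (k : ℝ) :
    ∃ a b c d : ℂ, (∀ n, boundaryFourier α β n k = (halfLine a b c d n 0).2) ∧
      d = (starRingEnd ℂ) a ∧ c = -(starRingEnd ℂ) b ∧
      Complex.normSq a + Complex.normSq b = 1 ∧
      b = -((Real.sin (α + β) * Real.cos k : ℝ) +
        (Real.sin (α - β) * Real.sin k : ℝ) * Complex.I) ∧
      c = (Real.sin (α + β) * Real.cos k : ℝ) -
        (Real.sin (α - β) * Real.sin k : ℝ) * Complex.I := by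
  set a : ℂ := Real.cos (α + β) * Real.cos k - Real.cos (α - β) * Real.sin k * Complex.I with ha
  set b : ℂ := -(Real.sin (α + β) * Real.cos k + Real.sin (α - β) * Real.sin k * Complex.I) with hb
  set c : ℂ := Real.sin (α + β) * Real.cos k - Real.sin (α - β) * Real.sin k * Complex.I with hc
  set d : ℂ := Real.cos (α + β) * Real.cos k + Real.cos (α - β) * Real.sin k * Complex.I with hd
  refine ⟨a, b, c, d, fun n => ?_, ?_, ?_, ?_, ?_, ?_⟩
  · obtain ⟨a', b', c', d', h, h1, h2, h3, h4⟩ := boundaryFourier_eq_halfLine α β n k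
    rw [h, h1, h2, h3, h4]
  · simp [ha, hd, Complex.conj_ofReal, -Complex.ofReal_cos, -Complex.ofReal_sin]
  · simp [hb, hc, Complex.conj_ofReal, -Complex.ofReal_cos, -Complex.ofReal_sin]
    ring
  · have e1 : a = ((Real.cos (α + β) * Real.cos k : ℝ) : ℂ) +
        ((-(Real.cos (α - β) * Real.sin k) : ℝ) : ℂ) * Complex.I := by
      rw [ha]; push_cast; ring
    have e2 : b = ((-(Real.sin (α + β) * Real.cos k) : ℝ) : ℂ) +
        ((-(Real.sin (α - β) * Real.sin k) : ℝ) : ℂ) * Complex.I := by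
      rw [hb]; push_cast; ring
    rw [e1, e2, Complex.normSq_add_mul_I, Complex.normSq_add_mul_I]
    linear_combination Real.cos k ^ 2 * Real.sin_sq_add_cos_sq (α + β) +
      Real.sin k ^ 2 * Real.sin_sq_add_cos_sq (α - β) + Real.sin_sq_add_cos_sq k
  · rw [hb]; push_cast; ring
  · rw [hc]; push_cast; ring

theorem norm_boundaryFourier_le (α β : ℝ) (n : ℕ) (k : ℝ) : ‖boundaryFourier α β n k‖ ≤ 1 := by
  obtain ⟨a, b, c, d, h, hd, hc, hab, -, -⟩ := boundaryFourier_exists_coin α β k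
  have h1 := halfLine_norm_sum_le hd hc hab n 1
  rw [Finset.sum_range_one, ← h] at h1
  have h2 := Complex.normSq_nonneg (halfLine a b c d n 0).1
  rw [Complex.normSq_eq_norm_sq (boundaryFourier α β n k)] at h1
  exact abs_le_one_iff_mul_self_le_one.2 (by nlinarith) |> le_of_abs_le

/-- The contribution of the edge state to `boundaryFourier`. -/
noncomputable def edgeFourier (s r : ℝ) (n : ℕ) (k : ℝ) : ℂ :=
  edgeWeight (s * Real.cos k) (r * Real.sin k) *
    (starRingEnd ℂ) (edgePole (s * Real.cos k) (r * Real.sin k)) ^ n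

theorem sq_mul_sin_lt_one {r k : ℝ} (hr : r ^ 2 ≤ 1) (hk : Real.cos k ≠ 0) :
    (r * Real.sin k) ^ 2 < 1 := by
  have h1 : 0 < Real.cos k ^ 2 := by positivity
  have h2 := Real.sin_sq_add_cos_sq k
  nlinarith [mul_nonneg (sub_nonneg.2 hr) (sq_nonneg (Real.sin k))]

theorem sq_cos_add_sq_sin_le {s r : ℝ} (hs : s ^ 2 ≤ 1) (hr : r ^ 2 ≤ 1) (k : ℝ) :
    (s * Real.cos k) ^ 2 + (r * Real.sin k) ^ 2 ≤ 1 := by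
  have h2 := Real.sin_sq_add_cos_sq k
  nlinarith [mul_nonneg (sub_nonneg.2 hr) (sq_nonneg (Real.sin k)),
    mul_nonneg (sub_nonneg.2 hs) (sq_nonneg (Real.cos k))]

theorem tendsto_boundaryFourier_sub_edge {α β k : ℝ} (hs : Real.sin (α + β) ≠ 0)
    (hk : Real.cos k ≠ 0) :
    Tendsto (fun n => boundaryFourier α β n k -
      edgeFourier (Real.sin (α + β)) (Real.sin (α - β)) n k) atTop (𝓝 0) := by
  obtain ⟨a, b, c, d, h, hd, hc, hab, hb', hc'⟩ := boundaryFourier_exists_coin α β k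
  simp only [h, edgeFourier]
  refine tendsto_halfLine_sub_edge ?_ hb' hc' (mul_ne_zero hs hk)
    (sq_mul_sin_lt_one (Real.sin_sq_le_one _) hk)
    (sq_cos_add_sq_sin_le (Real.sin_sq_le_one _) (Real.sin_sq_le_one _) k)
  rw [hd, hc, mul_neg, sub_neg_eq_add, Complex.mul_conj, Complex.mul_conj]
  exact_mod_cast hab

theorem edgeWeight_nonneg (e v : ℝ) : 0 ≤ edgeWeight e v := by
  unfold edgeWeight; positivity

theorem edgeWeight_le_one {e v : ℝ} (h : e ^ 2 + v ^ 2 ≤ 1) : edgeWeight e v ≤ 1 := by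
  unfold edgeWeight
  refine div_le_one_of_le₀ ?_ (Real.sqrt_nonneg _)
  rw [← Real.sqrt_sq_eq_abs]
  exact Real.sqrt_le_sqrt (by linarith)

theorem norm_edgeFourier_le {s r : ℝ} (hs : s ^ 2 ≤ 1) (hr : r ^ 2 ≤ 1) (n : ℕ) (k : ℝ) :
    ‖edgeFourier s r n k‖ ≤ 1 := by
  have h := sq_cos_add_sq_sin_le hs hr k
  rw [edgeFourier, norm_mul, Complex.norm_real, Real.norm_of_nonneg (edgeWeight_nonneg _ _),
    norm_pow, Complex.norm_conj]
  by_cases he : s * Real.cos k = 0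
  · simp [edgeWeight, he]
  · rw [norm_edgePole he (by nlinarith [sq_nonneg (s * Real.cos k)]), one_pow, mul_one]
    exact edgeWeight_le_one h

theorem measurable_realSign : Measurable Real.sign := by
  have : Real.sign = fun x : ℝ => if x < 0 then -1 else if 0 < x then 1 else 0 := by
    ext x; rfl
  rw [this]
  exact Measurable.ite measurableSet_Iio measurable_const
    (Measurable.ite measurableSet_Ioi measurable_const measurable_const)

theorem measurable_edgeFourier (s r : ℝ) (n : ℕ) : Measurable (edgeFourier s r n) := by
  have hsign : Measurable fun k => Real.sign (s * Real.cos k) :=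
    measurable_realSign.comp (by fun_prop)
  have h1 : Measurable fun k => edgeWeight (s * Real.cos k) (r * Real.sin k) := by
    unfold edgeWeight
    exact (continuous_abs.measurable.comp (by fun_prop)).div (by fun_prop)
  have h2 : Measurable fun k => edgePole (s * Real.cos k) (r * Real.sin k) := by
    unfold edgePole
    have : Measurable fun k => -(Real.sign (s * Real.cos k) * √(1 - (r * Real.sin k) ^ 2)) :=
      (hsign.mul (by fun_prop)).neg
    have h3 := Complex.measurable_ofReal.comp this
    simp only [Function.comp_def] at h3
    push_cast at h3 ⊢
    exact h3.add (by fun_prop)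
  unfold edgeFourier
  exact (Complex.measurable_ofReal.comp h1).mul
    ((Complex.continuous_conj.measurable.comp h2).pow_const n)

theorem continuous_boundaryFourier (α β : ℝ) (n : ℕ) : Continuous (boundaryFourier α β n) := by
  unfold boundaryFourier
  fun_prop

theorem ae_cos_ne_zero : ∀ᵐ k : ℝ, Real.cos k ≠ 0 := by
  have hc : Set.Countable {k : ℝ | Real.cos k = 0} := by
    refine (Set.countable_range fun n : ℤ => (2 * (n : ℝ) + 1) * Real.pi / 2).mono ?_
    intro k hk
    obtain ⟨n, hn⟩ := Real.cos_eq_zero_iff.1 hk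
    exact ⟨n, hn.symm⟩
  have := hc.measure_zero volume
  rwa [← compl_mem_ae_iff] at this

/-! ### Group velocity of the edge state. -/

/-- The group velocity of the edge state. -/
noncomputable def edgeVelocity (s r k : ℝ) : ℝ :=
  Real.sign s * r * |Real.cos k| / Real.sqrt (1 - (r * Real.sin k) ^ 2)

theorem sign_mul_eq_abs {e : ℝ} : Real.sign e * e = |e| := by
  rcases lt_trichotomy e 0 with h | h | h
  · rw [abs_of_neg h, Real.sign_of_neg h]; ring
  · simp [h]
  · rw [abs_of_pos h, Real.sign_of_pos h]; ring

theorem sign_mul_sign (x y : ℝ) : Real.sign (x * y) = Real.sign x * Real.sign y := by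
  rcases lt_trichotomy x 0 with hx | hx | hx <;> rcases lt_trichotomy y 0 with hy | hy | hy <;>
    simp [hx, hy, Real.sign_of_neg, Real.sign_of_pos, mul_pos_of_neg_of_neg, mul_neg_of_neg_of_pos,
      mul_neg_of_pos_of_neg]

/-- The conjugate pole is unimodular, so its logarithmic derivative is imaginary. The sign in
`edgePole` is locally constant where cos k ≠ 0, and only the square root and the sine are
differentiated. -/
theorem hasDerivAt_conj_edgePole {s r k : ℝ} (hs : s ≠ 0) (hr : r ^ 2 ≤ 1)
    (hk : Real.cos k ≠ 0) :
    HasDerivAt (fun k => (starRingEnd ℂ) (edgePole (s * Real.cos k) (r * Real.sin k)))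
      (Complex.I * edgeVelocity s r k *
        (starRingEnd ℂ) (edgePole (s * Real.cos k) (r * Real.sin k))) k := by
  have he : s * Real.cos k ≠ 0 := mul_ne_zero hs hk
  have hv := sq_mul_sin_lt_one hr hk
  set σ : ℝ := Real.sign (s * Real.cos k) with hσ
  have hσ2 : σ ^ 2 = 1 := sign_sq he
  have hev : ∀ᶠ x in 𝓝 k, Real.sign (s * Real.cos x) = σ := by
    have hcont : ContinuousAt (fun x => s * Real.cos x) k := by fun_prop
    rcases he.lt_or_gt with h | h
    · filter_upwards [hcont.eventually (gt_mem_nhds h)] with x hx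
      rw [hσ, Real.sign_of_neg hx, Real.sign_of_neg h]
    · filter_upwards [hcont.eventually (lt_mem_nhds h)] with x hx
      rw [hσ, Real.sign_of_pos hx, Real.sign_of_pos h]
  set q : ℝ := Real.sqrt (1 - (r * Real.sin k) ^ 2) with hq
  have hq0 : 0 < q := Real.sqrt_pos.2 (by linarith)
  have hq2 : q ^ 2 = 1 - (r * Real.sin k) ^ 2 := Real.sq_sqrt (by linarith)
  have hsin : HasDerivAt (fun x => r * Real.sin x) (r * Real.cos k) k :=
    (Real.hasDerivAt_sin k).const_mul r
  have hsqrt : HasDerivAt (fun x => -(σ * Real.sqrt (1 - (r * Real.sin x) ^ 2)))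
      (-(σ * (-(2 * (r * Real.sin k) * (r * Real.cos k)) / (2 * q)))) k := by
    have h1 : HasDerivAt (fun x => 1 - (r * Real.sin x) ^ 2)
        (-(2 * (r * Real.sin k) * (r * Real.cos k))) k := by
      have := (hsin.pow 2).const_sub 1
      simpa using this
    exact ((h1.sqrt (by linarith)).const_mul σ).neg
  have hmain : HasDerivAt (fun x => ((-(σ * Real.sqrt (1 - (r * Real.sin x) ^ 2)) : ℝ) : ℂ) -
      ((r * Real.sin x : ℝ) : ℂ) * Complex.I)
      (((-(σ * (-(2 * (r * Real.sin k) * (r * Real.cos k)) / (2 * q))) : ℝ) : ℂ) -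
        ((r * Real.cos k : ℝ) : ℂ) * Complex.I) k :=
    hsqrt.ofReal_comp.sub (hsin.ofReal_comp.mul_const Complex.I)
  have hform : ∀ x, (starRingEnd ℂ) (edgePole (s * Real.cos x) (r * Real.sin x)) =
      ((-(Real.sign (s * Real.cos x) * Real.sqrt (1 - (r * Real.sin x) ^ 2)) : ℝ) : ℂ) -
      ((r * Real.sin x : ℝ) : ℂ) * Complex.I := by
    intro x
    simp only [edgePole, map_add, map_mul, Complex.conj_ofReal, Complex.conj_I, map_neg]
    push_cast; ring
  have hX : edgeVelocity s r k = σ * r * Real.cos k / q := by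
    have h1 : Real.sign s * |Real.cos k| = σ * Real.cos k := by
      rw [hσ, sign_mul_sign, mul_assoc, sign_mul_eq_abs]
    rw [edgeVelocity, ← hq]
    congr 1
    linear_combination r * h1
  have hval : (((-(σ * (-(2 * (r * Real.sin k) * (r * Real.cos k)) / (2 * q))) : ℝ) : ℂ) -
        ((r * Real.cos k : ℝ) : ℂ) * Complex.I) =
      Complex.I * edgeVelocity s r k *
        (starRingEnd ℂ) (edgePole (s * Real.cos k) (r * Real.sin k)) := by
    rw [hform, hX, ← hσ, ← hq]
    have hq0' : (q : ℂ) ≠ 0 := by exact_mod_cast hq0.ne'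
    have hσ2' : (σ : ℂ) ^ 2 = 1 := by exact_mod_cast hσ2
    generalize Real.cos k = C at *
    generalize Real.sin k = S at *
    push_cast
    field_simp
    linear_combination (C * q * r * Complex.I) * hσ2' + σ * C * r ^ 2 * S * Complex.I_sq
  rw [← hval]
  refine hmain.congr_of_eventuallyEq ?_
  filter_upwards [hev] with x hx
  rw [hform, hx]

/-- The phases combine to the n-th power of τ(k)·conj(τ(k + t/n)) = 1 + itV/n + o(1/n), where V is
the group velocity. -/
theorem tendsto_conj_edgeFourier_mul {s r k : ℝ} (hs : s ≠ 0) (hr : r ^ 2 ≤ 1)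
    (hk : Real.cos k ≠ 0) (t : ℝ) :
    Tendsto (fun n : ℕ => (starRingEnd ℂ) (edgeFourier s r n k) *
      edgeFourier s r n (k + (n : ℝ)⁻¹ * t)) atTop
      (𝓝 (edgeWeight (s * Real.cos k) (r * Real.sin k) ^ 2 *
        Complex.exp (t * edgeVelocity s r k * Complex.I))) := by
  have he : s * Real.cos k ≠ 0 := mul_ne_zero hs hk
  have hv := sq_mul_sin_lt_one hr hk
  set τ : ℝ → ℂ := fun k => edgePole (s * Real.cos k) (r * Real.sin k) with hτ
  set w : ℝ → ℝ := fun k => edgeWeight (s * Real.cos k) (r * Real.sin k) with hw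
  have hinv : Tendsto (fun n : ℕ => (n : ℝ)⁻¹) atTop (𝓝[>] 0) :=
    tendsto_inv_atTop_nhdsGT_zero.comp tendsto_natCast_atTop_atTop
  have hshift : Tendsto (fun n : ℕ => k + (n : ℝ)⁻¹ * t) atTop (𝓝 k) := by
    have := ((hinv.mono_right nhdsWithin_le_nhds).mul_const t).const_add k
    simpa using this
  have hwc : Tendsto (fun n : ℕ => w (k + (n : ℝ)⁻¹ * t)) atTop (𝓝 (w k)) := by
    have : ContinuousAt w k := by
      simp only [hw]
      unfold edgeWeight
      refine ContinuousAt.div (by fun_prop) (by fun_prop) ?_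
      exact (Real.sqrt_pos.2 (by linarith)).ne'
    exact this.tendsto.comp hshift
  have hone : τ k * (starRingEnd ℂ) (τ k) = 1 := edgePole_mul_conj he hv.le
  have hd : HasDerivAt (fun u : ℝ => τ k * (starRingEnd ℂ) (τ (k + u * t)))
      (t * edgeVelocity s r k * Complex.I) 0 := by
    have h1 := hasDerivAt_conj_edgePole hs hr hk
    have h2 : HasDerivAt (fun u : ℝ => k + u * t) t 0 := by
      simpa using ((hasDerivAt_id (0 : ℝ)).mul_const t).const_add k
    have h1' : HasDerivAt (fun k => (starRingEnd ℂ) (τ k))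
      (Complex.I * edgeVelocity s r k * (starRingEnd ℂ) (τ k)) (k + 0 * t) := by
      simpa using h1
    have h3 := (HasDerivAt.scomp (0 : ℝ) h1' h2).const_mul (τ k)
    refine h3.congr_deriv ?_
    rw [Complex.real_smul]
    linear_combination (t * edgeVelocity s r k * Complex.I) * hone
  have hslope := hd.tendsto_slope_zero.comp (hinv.mono_right (nhdsGT_le_nhdsNE 0))
  have hpow := Complex.tendsto_one_add_pow_exp_of_tendsto
    (g := fun n : ℕ => τ k * (starRingEnd ℂ) (τ (k + (n : ℝ)⁻¹ * t)) - 1)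
    (t := t * edgeVelocity s r k * Complex.I) (by
      refine hslope.congr fun n => ?_
      simp only [Function.comp_apply, zero_add, zero_mul, add_zero, inv_inv, hone]
      rw [Complex.real_smul]
      norm_num)
  have hlim := ((Complex.continuous_ofReal.tendsto _).comp hwc).const_mul (w k : ℂ) |>.mul hpow
  rw [← sq] at hlim
  refine hlim.congr fun n => ?_
  simp only [edgeFourier, map_mul, map_pow, Complex.conj_conj, Complex.conj_ofReal,
    Function.comp_apply, add_sub_cancel, mul_pow, hw, hτ]
  ring


/-! ### Fourier inversion and shifted overlaps. -/

theorem integral_exp_int_mul (m : ℤ) :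
    ∫ k in -Real.pi..Real.pi, Complex.exp (m * k * Complex.I) =
      if m = 0 then 2 * (Real.pi : ℂ) else 0 := by
  split_ifs with h
  · simp [h]; ring
  · have hc : (m * Complex.I : ℂ) ≠ 0 := by simp [h]
    have e : ∀ k : ℝ, (m * k * Complex.I : ℂ) = (m * Complex.I) * k := fun k => by ring
    simp only [e]
    rw [integral_exp_mul_complex hc]
    have h2 : Complex.exp (m * Complex.I * (Real.pi : ℝ)) =
        Complex.exp (m * Complex.I * ((-Real.pi : ℝ) : ℂ)) := by
      rw [Complex.exp_eq_exp_iff_exists_int]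
      exact ⟨m, by push_cast; ring⟩
    rw [h2, sub_self, zero_div]

theorem conj_exp_mul_I (x : ℝ) :
    (starRingEnd ℂ) (Complex.exp (x * Complex.I)) = Complex.exp (-(x * Complex.I)) := by
  rw [← Complex.exp_conj]; simp

theorem integral_boundaryFourier_mul_exp (α β : ℝ) (n : ℕ) (j : ℤ) :
    ∫ k in -Real.pi..Real.pi, boundaryFourier α β n k * Complex.exp (-(j * k * Complex.I)) =
      2 * Real.pi * (boundaryPoly α β n).coeff j := by
  have e : ∀ k : ℝ, boundaryFourier α β n k * Complex.exp (-(j * k * Complex.I)) =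
      ∑ i ∈ (boundaryPoly α β n).coeff.support, (boundaryPoly α β n).coeff i *
        Complex.exp (((i - j : ℤ) : ℂ) * k * Complex.I) := by
    intro k
    rw [boundaryFourier, Finset.sum_mul]
    refine Finset.sum_congr rfl fun i _ => ?_
    rw [mul_assoc, ← Complex.exp_add]
    congr 2
    push_cast; ring
  simp only [e]
  rw [intervalIntegral.integral_finsetSum fun i _ =>
    (Continuous.intervalIntegrable (by fun_prop) _ _)]
  simp only [intervalIntegral.integral_const_mul, integral_exp_int_mul, sub_eq_zero]
  by_cases hj : (boundaryPoly α β n).coeff j = 0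
  · rw [hj, mul_zero]
    refine Finset.sum_eq_zero fun i hi => ?_
    rw [if_neg, mul_zero]
    rintro rfl
    exact (Finsupp.mem_support_iff.1 hi) hj
  · rw [Finset.sum_eq_single j]
    · simp; ring
    · intro i _ hij; simp [hij]
    · intro h; exact absurd (Finsupp.mem_support_iff.2 hj) h

/-- Parseval's identity: a shift of the momentum by h multiplies the amplitude at j by exp(ijh).
With h = t/n this is the characteristic function of the rescaled position. -/
theorem integral_conj_boundaryFourier_mul (α β : ℝ) (n : ℕ) (h : ℝ) :
    ∫ k in -Real.pi..Real.pi, (starRingEnd ℂ) (boundaryFourier α β n k) *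
        boundaryFourier α β n (k + h) =
      2 * Real.pi * ∑ j ∈ (boundaryPoly α β n).coeff.support,
        (boundaryProb α β n j : ℂ) * Complex.exp (j * h * Complex.I) := by
  have e : ∀ k : ℝ, (starRingEnd ℂ) (boundaryFourier α β n k) *
      boundaryFourier α β n (k + h) =
      ∑ j ∈ (boundaryPoly α β n).coeff.support, ((starRingEnd ℂ) ((boundaryPoly α β n).coeff j) *
        Complex.exp (j * h * Complex.I)) *
        (starRingEnd ℂ) ((starRingEnd ℂ) (boundaryFourier α β n (k + h)) *
          Complex.exp (j * (k + h : ℝ) * Complex.I)) := by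
    intro k
    conv_lhs => rw [boundaryFourier, map_sum, Finset.sum_mul]
    refine Finset.sum_congr rfl fun i _ => ?_
    rw [map_mul, map_mul, Complex.conj_conj]
    have h1 := conj_exp_mul_I (i * k)
    have h2 := conj_exp_mul_I (i * (k + h))
    push_cast at h1 h2 ⊢
    rw [h1, h2]
    have h3 : Complex.exp (-(i * k * Complex.I)) =
      Complex.exp (i * h * Complex.I) * Complex.exp (-(i * (k + h) * Complex.I)) := by
      rw [← Complex.exp_add]; congr 1; ring
    rw [h3]; ring
  have e' : ∀ (i : ℤ) (k : ℝ), (starRingEnd ℂ) ((starRingEnd ℂ) (boundaryFourier α β n k) *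
          Complex.exp (i * k * Complex.I)) =
      boundaryFourier α β n k * Complex.exp (-(i * k * Complex.I)) := by
    intro i k
    have h2 := conj_exp_mul_I (i * k)
    push_cast at h2
    rw [map_mul, Complex.conj_conj, h2]
  simp only [e, e']
  have hc := continuous_boundaryFourier α β n
  have hper : ∀ j : ℤ, Function.Periodic
      (fun k : ℝ => boundaryFourier α β n k * Complex.exp (-(j * k * Complex.I)))
      (2 * Real.pi) := by
    have hexp : ∀ (j : ℤ) (k : ℝ), Complex.exp (j * (k + 2 * Real.pi : ℝ) * Complex.I) =
        Complex.exp (j * k * Complex.I) := by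
      intro j k
      rw [Complex.exp_eq_exp_iff_exists_int]
      exact ⟨j, by push_cast; ring⟩
    intro j k
    have h1 : boundaryFourier α β n (k + 2 * Real.pi) = boundaryFourier α β n k := by
      simp only [boundaryFourier, hexp]
    have h2 := hexp (-j) k
    push_cast at h2 ⊢
    simp only [h1]
    congr 1
    simpa using h2
  rw [intervalIntegral.integral_finsetSum fun i _ =>
    (Continuous.intervalIntegrable (by fun_prop) _ _), Finset.mul_sum]
  refine Finset.sum_congr rfl fun j _ => ?_
  rw [intervalIntegral.integral_const_mul,
    intervalIntegral.integral_comp_add_right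
      (fun k : ℝ => boundaryFourier α β n k * Complex.exp (-(j * k * Complex.I))) h]
  have h3 := (hper j).intervalIntegral_add_eq (-Real.pi + h) (-Real.pi)
  rw [show -Real.pi + h + 2 * Real.pi = Real.pi + h by ring,
    show -Real.pi + 2 * Real.pi = Real.pi by ring] at h3
  rw [h3, integral_boundaryFourier_mul_exp, boundaryProb_eq]
  have h4 : (starRingEnd ℂ) ((boundaryPoly α β n).coeff j) * (boundaryPoly α β n).coeff j =
      ((‖(boundaryPoly α β n).coeff j‖ ^ 2 : ℝ) : ℂ) := by
    rw [mul_comm, Complex.mul_conj, Complex.normSq_eq_norm_sq]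
  rw [← h4]; ring

theorem boundaryFourier_periodic (α β : ℝ) (n : ℕ) :
    Function.Periodic (boundaryFourier α β n) (2 * Real.pi) := by
  intro k
  simp only [boundaryFourier]
  refine Finset.sum_congr rfl fun j _ => ?_
  congr 1
  rw [Complex.exp_eq_exp_iff_exists_int]
  exact ⟨j, by push_cast; ring⟩

theorem edgeFourier_periodic (s r : ℝ) (n : ℕ) :
    Function.Periodic (edgeFourier s r n) (2 * Real.pi) := by
  intro k
  simp only [edgeFourier, Real.cos_add_two_pi, Real.sin_add_two_pi]

/-! ### Replacing the boundary amplitude by the edge part in L¹. -/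

section Limits

variable {α β s r : ℝ}

theorem tendsto_integral_norm_sub_edge (hs : s = Real.sin (α + β)) (hr : r = Real.sin (α - β))
    (hs0 : s ≠ 0) :
    Tendsto (fun n => ∫ k in -Real.pi..Real.pi, ‖boundaryFourier α β n k - edgeFourier s r n k‖)
      atTop (𝓝 0) := by
  have hs1 : s ^ 2 ≤ 1 := hs ▸ Real.sin_sq_le_one _
  have hr1 : r ^ 2 ≤ 1 := hr ▸ Real.sin_sq_le_one _
  have h := intervalIntegral.tendsto_integral_filter_of_dominated_convergence (μ := volume)
    (l := atTop) (a := -Real.pi) (b := Real.pi)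
    (F := fun n k => ‖boundaryFourier α β n k - edgeFourier s r n k‖) (f := fun _ => 0)
    (fun _ => 2) (Eventually.of_forall fun n =>
      (((continuous_boundaryFourier α β n).measurable.sub
        (measurable_edgeFourier s r n)).norm).aestronglyMeasurable)
    (Eventually.of_forall fun n => ae_of_all _ fun k _ => by
      rw [norm_norm]
      refine (norm_sub_le _ _).trans ?_
      linarith [norm_boundaryFourier_le α β n k, norm_edgeFourier_le hs1 hr1 n k])
    intervalIntegrable_const
    (by
      filter_upwards [ae_cos_ne_zero] with k hk _
      subst hs hr
      exact tendsto_zero_iff_norm_tendsto_zero.1 (tendsto_boundaryFourier_sub_edge hs0 hk))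
  simpa using h

theorem intervalIntegrable_of_bounded {f : ℝ → ℂ} (hf : Measurable f) {C : ℝ} (hC : ∀ k, ‖f k‖ ≤ C)
    (a b : ℝ) : IntervalIntegrable f volume a b :=
  (intervalIntegrable_const (c := C)).mono_fun hf.aestronglyMeasurable
    (ae_of_all _ fun k => (hC k).trans (le_abs_self C))

theorem tendsto_integral_conj_boundaryFourier_mul (hs : s = Real.sin (α + β))
    (hr : r = Real.sin (α - β)) (hs0 : s ≠ 0) (t : ℝ) :
    Tendsto (fun n : ℕ => ∫ k in -Real.pi..Real.pi, (starRingEnd ℂ) (boundaryFourier α β n k) *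
        boundaryFourier α β n (k + (n : ℝ)⁻¹ * t)) atTop
      (𝓝 (∫ k in -Real.pi..Real.pi, (edgeWeight (s * Real.cos k) (r * Real.sin k) : ℂ) ^ 2 *
        Complex.exp (t * edgeVelocity s r k * Complex.I))) := by
  have hs1 : s ^ 2 ≤ 1 := hs ▸ Real.sin_sq_le_one _
  have hr1 : r ^ 2 ≤ 1 := hr ▸ Real.sin_sq_le_one _
  have hM := norm_boundaryFourier_le α β
  have hP := norm_edgeFourier_le hs1 hr1
  have mM : ∀ n, Measurable (boundaryFourier α β n) :=
    fun n => (continuous_boundaryFourier α β n).measurable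
  have mP := measurable_edgeFourier s r
  have mconj : Measurable (starRingEnd ℂ) := Complex.continuous_conj.measurable
  have h1 := intervalIntegral.tendsto_integral_filter_of_dominated_convergence (μ := volume)
    (l := atTop) (a := -Real.pi) (b := Real.pi)
    (F := fun (n : ℕ) k => (starRingEnd ℂ) (edgeFourier s r n k) *
      edgeFourier s r n (k + (n : ℝ)⁻¹ * t))
    (f := fun k => (edgeWeight (s * Real.cos k) (r * Real.sin k) : ℂ) ^ 2 *
        Complex.exp (t * edgeVelocity s r k * Complex.I))
    (fun _ => 1) (Eventually.of_forall fun n =>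
      ((mconj.comp (mP n)).mul ((mP n).comp (measurable_add_const _))).aestronglyMeasurable)
    (Eventually.of_forall fun n => ae_of_all _ fun k _ => by
      rw [norm_mul, Complex.norm_conj]
      exact mul_le_one₀ (hP n k) (norm_nonneg _) (hP n _))
    intervalIntegrable_const
    (by
      filter_upwards [ae_cos_ne_zero] with k hk _
      exact tendsto_conj_edgeFourier_mul hs0 hr1 hk t)
  have h2 : Tendsto (fun n : ℕ => (∫ k in -Real.pi..Real.pi,
      (starRingEnd ℂ) (boundaryFourier α β n k) * boundaryFourier α β n (k + (n : ℝ)⁻¹ * t)) -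
      ∫ k in -Real.pi..Real.pi, (starRingEnd ℂ) (edgeFourier s r n k) *
        edgeFourier s r n (k + (n : ℝ)⁻¹ * t)) atTop (𝓝 0) := by
    have h0 := (tendsto_integral_norm_sub_edge hs hr hs0).const_mul 2
    rw [mul_zero] at h0
    refine squeeze_zero_norm (fun n => ?_) h0
    set D : ℝ → ℂ := fun k => boundaryFourier α β n k - edgeFourier s r n k with hD
    have mD : Measurable D := (mM n).sub (mP n)
    have bD : ∀ k, ‖D k‖ ≤ 2 := fun k =>
      (norm_sub_le _ _).trans (by linarith [hM n k, hP n k])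
    have iD : ∀ a b, IntervalIntegrable (fun k => ‖D k‖) volume a b :=
      fun a b => (intervalIntegrable_of_bounded mD bD a b).norm
    set h : ℝ := (n : ℝ)⁻¹ * t
    have iD' : IntervalIntegrable (fun k => ‖D (k + h)‖) volume (-Real.pi) Real.pi :=
      (intervalIntegrable_of_bounded (mD.comp (measurable_add_const h)) (fun k => bD _) _ _).norm
    rw [← intervalIntegral.integral_sub
      (intervalIntegrable_of_bounded (C := 1)
        (f := fun k => (starRingEnd ℂ) (boundaryFourier α β n k) * boundaryFourier α β n (k + h))
        ((mconj.comp (mM n)).mul ((mM n).comp (measurable_add_const h))) (fun k => by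
          rw [norm_mul, Complex.norm_conj]; exact mul_le_one₀ (hM n k) (norm_nonneg _) (hM n _)) _ _)
      (intervalIntegrable_of_bounded (C := 1)
        (f := fun k => (starRingEnd ℂ) (edgeFourier s r n k) * edgeFourier s r n (k + h))
        ((mconj.comp (mP n)).mul ((mP n).comp (measurable_add_const h))) (fun k => by
          rw [norm_mul, Complex.norm_conj]; exact mul_le_one₀ (hP n k) (norm_nonneg _) (hP n _)) _ _)]
    have hshift : ∫ k in -Real.pi..Real.pi, ‖D (k + h)‖ = ∫ k in -Real.pi..Real.pi, ‖D k‖ := by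
      rw [intervalIntegral.integral_comp_add_right (fun k => ‖D k‖) h]
      have hper : Function.Periodic (fun k => ‖D k‖) (2 * Real.pi) := fun k => by
        simp only [hD, boundaryFourier_periodic α β n k, edgeFourier_periodic s r n k]
      have h3 := hper.intervalIntegral_add_eq (-Real.pi + h) (-Real.pi)
      rwa [show -Real.pi + h + 2 * Real.pi = Real.pi + h by ring,
        show -Real.pi + 2 * Real.pi = Real.pi by ring] at h3
    have hle : -Real.pi ≤ Real.pi := by linarith [Real.pi_pos]
    calc _ ≤ ∫ k in -Real.pi..Real.pi, (‖D k‖ + ‖D (k + h)‖) := by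
          refine intervalIntegral.norm_integral_le_of_norm_le hle (ae_of_all _ fun k _ => ?_)
            ((iD _ _).add iD')
          -- The difference of products is telescoped, so that each term has one factor `D` and one
          -- factor bounded by 1; periodicity makes both integrals of ‖D‖ equal.
          have e : (starRingEnd ℂ) (boundaryFourier α β n k) * boundaryFourier α β n (k + h) -
              (starRingEnd ℂ) (edgeFourier s r n k) * edgeFourier s r n (k + h) =
              (starRingEnd ℂ) (D k) * boundaryFourier α β n (k + h) +
                (starRingEnd ℂ) (edgeFourier s r n k) * D (k + h) := by
            simp only [hD, map_sub]; ring
          rw [e]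
          refine (norm_add_le _ _).trans (add_le_add ?_ ?_)
          · rw [norm_mul, Complex.norm_conj]
            exact mul_le_of_le_one_right (norm_nonneg _) (hM n _)
          · rw [norm_mul, Complex.norm_conj]
            exact mul_le_of_le_one_left (norm_nonneg _) (hP n _)
      _ = 2 * ∫ k in -Real.pi..Real.pi, ‖D k‖ := by
          rw [intervalIntegral.integral_add (iD _ _) iD', hshift]; ring
  simpa using h2.add h1

/-- The amplitude at any moving site is asymptotically the Fourier coefficient of the edge part. -/
theorem tendsto_coeff_sub_edge (hs : s = Real.sin (α + β))
    (hr : r = Real.sin (α - β)) (hs0 : s ≠ 0) (j : ℕ → ℤ) :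
    Tendsto (fun n : ℕ => (boundaryPoly α β n).coeff (j n) - (2 * Real.pi : ℂ)⁻¹ *
      ∫ k in -Real.pi..Real.pi, edgeFourier s r n k * Complex.exp (-(j n * k * Complex.I)))
      atTop (𝓝 0) := by
  have hs1 : s ^ 2 ≤ 1 := hs ▸ Real.sin_sq_le_one _
  have hr1 : r ^ 2 ≤ 1 := hr ▸ Real.sin_sq_le_one _
  have h0 := (tendsto_integral_norm_sub_edge hs hr hs0).const_mul (2 * Real.pi)⁻¹
  rw [mul_zero] at h0
  -- The L¹ bound does not see the unimodular factor, hence is uniform in the site; this is why `j`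
  -- may depend on n.
  refine squeeze_zero_norm (fun n => ?_) h0
  have hpi : (Real.pi : ℂ) ≠ 0 := by exact_mod_cast Real.pi_ne_zero
  have hle : -Real.pi ≤ Real.pi := by linarith [Real.pi_pos]
  have mM : Measurable (boundaryFourier α β n) := (continuous_boundaryFourier α β n).measurable
  have mP := measurable_edgeFourier s r n
  have hne : ∀ k : ℝ, ‖Complex.exp (-(j n * k * Complex.I))‖ = 1 := fun k => by
    have := Complex.norm_exp_ofReal_mul_I (-(j n * k))
    push_cast at this
    rw [← this]; congr 2; ring
  have me : Measurable fun k : ℝ => Complex.exp (-(j n * k * Complex.I)) := by fun_prop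
  have e : (boundaryPoly α β n).coeff (j n) = (2 * Real.pi : ℂ)⁻¹ *
      ∫ k in -Real.pi..Real.pi, boundaryFourier α β n k * Complex.exp (-(j n * k * Complex.I)) := by
    rw [integral_boundaryFourier_mul_exp, ← mul_assoc, inv_mul_cancel₀ (by simp [hpi]), one_mul]
  rw [e, ← mul_sub, ← intervalIntegral.integral_sub
    (intervalIntegrable_of_bounded (C := 1)
      (f := fun k => boundaryFourier α β n k * Complex.exp (-(j n * k * Complex.I))) (mM.mul me) (fun k => by
      rw [norm_mul, hne, mul_one]; exact norm_boundaryFourier_le α β n k) _ _)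
    (intervalIntegrable_of_bounded (C := 1)
      (f := fun k => edgeFourier s r n k * Complex.exp (-(j n * k * Complex.I))) (mP.mul me) (fun k => by
      rw [norm_mul, hne, mul_one]; exact norm_edgeFourier_le hs1 hr1 n k) _ _), norm_mul]
  have hn : ‖(2 * Real.pi : ℂ)⁻¹‖ = (2 * Real.pi)⁻¹ := by
    rw [norm_inv, norm_mul, Complex.norm_real, Real.norm_of_nonneg Real.pi_pos.le]; simp
  rw [hn]
  refine mul_le_mul_of_nonneg_left ?_ (by positivity)
  refine intervalIntegral.norm_integral_le_of_norm_le hle (ae_of_all _ fun k _ => ?_)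
    (intervalIntegrable_of_bounded (C := 2) (mM.sub mP) (fun k =>
      (norm_sub_le _ _).trans (by
        linarith [norm_boundaryFourier_le α β n k, norm_edgeFourier_le hs1 hr1 n k])) _ _).norm
  rw [← sub_mul, norm_mul, hne, mul_one]

end Limits


/-! ### Total mass and characteristic function. -/

section Mass

variable {α β s r : ℝ}

theorem boundaryProb_nonneg (α β : ℝ) (n : ℕ) (j : ℤ) : 0 ≤ boundaryProb α β n j := by
  rw [boundaryProb_eq]; positivity

theorem tsum_boundaryProb_mul (α β : ℝ) (n : ℕ) (h : ℤ → ℂ) :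
    ∑' j, (boundaryProb α β n j : ℂ) * h j =
      ∑ j ∈ (boundaryPoly α β n).coeff.support, (boundaryProb α β n j : ℂ) * h j := by
  refine tsum_eq_sum fun j hj => ?_
  rw [boundaryProb_eq, Finsupp.notMem_support_iff.1 hj]
  simp

theorem tendsto_tsum_boundaryProb_mul_exp (hs : s = Real.sin (α + β))
    (hr : r = Real.sin (α - β)) (hs0 : s ≠ 0) (t : ℝ) :
    Tendsto (fun n : ℕ => ∑' j : ℤ, (boundaryProb α β n j : ℂ) *
        Complex.exp (j * ((n : ℝ)⁻¹ * t : ℝ) * Complex.I)) atTop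
      (𝓝 ((2 * Real.pi : ℂ)⁻¹ *
        ∫ k in -Real.pi..Real.pi, (edgeWeight (s * Real.cos k) (r * Real.sin k) : ℂ) ^ 2 *
          Complex.exp (t * edgeVelocity s r k * Complex.I))) := by
  have hpi : (2 * Real.pi : ℂ) ≠ 0 := by simp [Real.pi_ne_zero]
  refine ((tendsto_integral_conj_boundaryFourier_mul hs hr hs0 t).const_mul
    (2 * Real.pi : ℂ)⁻¹).congr fun n => ?_
  rw [integral_conj_boundaryFourier_mul, ← mul_assoc, inv_mul_cancel₀ hpi, one_mul,
    tsum_boundaryProb_mul]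

theorem tendsto_tsum_boundaryProb (hs : s = Real.sin (α + β))
    (hr : r = Real.sin (α - β)) (hs0 : s ≠ 0) :
    Tendsto (fun n : ℕ => ∑' j : ℤ, boundaryProb α β n j) atTop
      (𝓝 ((2 * Real.pi)⁻¹ *
        ∫ k in -Real.pi..Real.pi, edgeWeight (s * Real.cos k) (r * Real.sin k) ^ 2)) := by
  have h := (Complex.continuous_re.tendsto _).comp (tendsto_tsum_boundaryProb_mul_exp hs hr hs0 0)
  have e1 : ((2 * Real.pi : ℂ)⁻¹ *
        ∫ k in -Real.pi..Real.pi, (edgeWeight (s * Real.cos k) (r * Real.sin k) : ℂ) ^ 2 *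
          Complex.exp ((0 : ℝ) * edgeVelocity s r k * Complex.I)) =
      (((2 * Real.pi)⁻¹ *
        ∫ k in -Real.pi..Real.pi, edgeWeight (s * Real.cos k) (r * Real.sin k) ^ 2 : ℝ) : ℂ) := by
    push_cast
    rw [← intervalIntegral.integral_ofReal]
    simp
  rw [e1, Complex.ofReal_re] at h
  refine h.congr fun n => ?_
  simp only [Function.comp_apply, mul_zero, Complex.ofReal_zero, zero_mul, Complex.exp_zero, mul_one]
  rw [← Complex.ofReal_tsum, Complex.ofReal_re]

/-- Bounds the Cesàro averages from above, which a lower estimate for a real-valued `limsup`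
requires. -/
theorem boundaryProb_le_one (α β : ℝ) (n : ℕ) (j : ℤ) : boundaryProb α β n j ≤ 1 := by
  rw [boundaryProb_eq]
  have h := integral_boundaryFourier_mul_exp α β n j
  have hb : ‖∫ k in -Real.pi..Real.pi, boundaryFourier α β n k *
      Complex.exp (-(j * k * Complex.I))‖ ≤ 1 * |Real.pi - -Real.pi| := by
    refine intervalIntegral.norm_integral_le_of_norm_le_const fun k _ => ?_
    have := Complex.norm_exp_ofReal_mul_I (-(j * k))
    push_cast at this
    rw [norm_mul, ← neg_mul, this, mul_one]
    exact norm_boundaryFourier_le α β n k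
  rw [h, norm_mul, norm_mul, Complex.norm_real, Real.norm_of_nonneg Real.pi_pos.le,
    show Real.pi - -Real.pi = 2 * Real.pi by ring, abs_of_pos (by positivity)] at hb
  have h2 : ‖(boundaryPoly α β n).coeff j‖ ≤ 1 := by
    have : ‖(2 : ℂ)‖ = 2 := by simp
    rw [this] at hb
    exact le_of_mul_le_mul_left (by linarith) (show 0 < 2 * Real.pi by positivity)
  exact pow_le_one₀ (norm_nonneg _) h2

end Mass

/-! ### Mass concentrating at one moving site. -/

section Concentration

variable {f : ℕ → ℤ → ℝ} {a : ℕ → ℤ} {m : ℝ}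

/-- The mass of a set containing `a n` is squeezed between the mass at `a n` and the total mass,
which share their limit. -/
theorem tendsto_tsum_subtype_of_mem (hf : ∀ n j, 0 ≤ f n j) (hs : ∀ n, Summable (f n))
    (ht : Tendsto (fun n => ∑' j, f n j) atTop (𝓝 m)) (ha : Tendsto (fun n => f n (a n)) atTop (𝓝 m))
    {E : ℕ → Set ℤ} (hE : ∀ᶠ n in atTop, a n ∈ E n) :
    Tendsto (fun n => ∑' j : E n, f n j) atTop (𝓝 m) := by
  refine tendsto_of_tendsto_of_tendsto_of_le_of_le' ha ht ?_ ?_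
  · filter_upwards [hE] with n hn
    exact ((hs n).subtype (E n)).le_tsum ⟨a n, hn⟩ fun _ _ => hf n _
  · exact Eventually.of_forall fun n => (hs n).tsum_subtype_le (f n) (E n) (hf n)

theorem tendsto_tsum_subtype_of_notMem (hf : ∀ n j, 0 ≤ f n j) (hs : ∀ n, Summable (f n))
    (ht : Tendsto (fun n => ∑' j, f n j) atTop (𝓝 m)) (ha : Tendsto (fun n => f n (a n)) atTop (𝓝 m))
    {E : ℕ → Set ℤ} (hE : ∀ᶠ n in atTop, a n ∉ E n) :
    Tendsto (fun n => ∑' j : E n, f n j) atTop (𝓝 0) := by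
  have h := tendsto_tsum_subtype_of_mem hf hs ht ha (E := fun n => (E n)ᶜ) hE
  have h2 := ht.sub h
  rw [sub_self] at h2
  refine h2.congr fun n => ?_
  rw [← ((hs n).subtype (E n)).tsum_add_tsum_compl ((hs n).subtype _)]
  ring

end Concentration

/-! ### The case |r| = 1. -/

section Ballistic

variable {α β s r : ℝ}

theorem sqrt_one_sub_sq_sin (hr : r ^ 2 = 1) (k : ℝ) :
    Real.sqrt (1 - (r * Real.sin k) ^ 2) = |Real.cos k| := by
  rw [← Real.sqrt_sq_eq_abs, mul_pow, hr]
  congr 1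
  linarith [Real.sin_sq_add_cos_sq k]

theorem edgeWeight_of_sq_eq_one (hr : r ^ 2 = 1) {k : ℝ} (hk : Real.cos k ≠ 0) :
    edgeWeight (s * Real.cos k) (r * Real.sin k) = |s| := by
  rw [edgeWeight, sqrt_one_sub_sq_sin hr, abs_mul, mul_div_assoc, div_self (abs_ne_zero.2 hk),
    mul_one]

/-- Now √(1 - v²) = |cos k|: the weight is constant and the conjugate pole is a sign times exp(iτk),
so the n-th power is one Fourier mode, sitting at the site τn. -/
theorem edgeFourier_of_sq_eq_one {τ : ℤ} (hτ : (τ : ℝ) = Real.sign s * r) (hs : s ≠ 0)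
    (hr : r ^ 2 = 1) (n : ℕ) {k : ℝ} (hk : Real.cos k ≠ 0) :
    edgeFourier s r n k = |s| * (-Real.sign s : ℝ) ^ n *
      Complex.exp ((τ * n : ℤ) * k * Complex.I) := by
  have hσ := sign_sq hs
  have h1 : Real.sign (s * Real.cos k) * |Real.cos k| = Real.sign s * Real.cos k := by
    have : Real.sign (Real.cos k) * |Real.cos k| = Real.cos k := by
      rw [← sign_mul_eq_abs, ← mul_assoc, ← sq, sign_sq hk, one_mul]
    rw [sign_mul_sign, mul_assoc, this]
  have hτ2 : τ = 1 ∨ τ = -1 := by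
    have : (τ : ℝ) ^ 2 = 1 := by rw [hτ, mul_pow, hσ, hr, one_mul]
    exact sq_eq_one_iff.1 (by exact_mod_cast this)
  have hexp : Complex.exp (τ * k * Complex.I) = Real.cos k + τ * Real.sin k * Complex.I := by
    rcases hτ2 with h | h
    · rw [h]; simp [Complex.exp_mul_I]
    · have := Complex.exp_mul_I (-k : ℂ)
      rw [h]; push_cast; rw [neg_one_mul, this]; simp
  have hpole : (starRingEnd ℂ) (edgePole (s * Real.cos k) (r * Real.sin k)) =
      (-Real.sign s : ℝ) * Complex.exp (τ * k * Complex.I) := by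
    have hr' : (r : ℂ) = Real.sign s * τ := by
      have : r = Real.sign s * τ := by rw [hτ, ← mul_assoc, ← sq, hσ, one_mul]
      exact_mod_cast this
    rw [edgePole, sqrt_one_sub_sq_sin hr, h1, hexp]
    simp only [map_add, map_mul, Complex.conj_ofReal, Complex.conj_I, Complex.ofReal_neg,
      Complex.ofReal_mul, map_neg]
    rw [hr']
    ring
  rw [edgeFourier, edgeWeight_of_sq_eq_one hr hk, hpole, mul_pow, ← Complex.exp_nat_mul, ← mul_assoc]
  congr 2
  push_cast; ring

theorem tendsto_tsum_boundaryProb_of_sq_eq_one (hs : s = Real.sin (α + β))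
    (hr : r = Real.sin (α - β)) (hs0 : s ≠ 0) (hr1 : r ^ 2 = 1) :
    Tendsto (fun n : ℕ => ∑' j : ℤ, boundaryProb α β n j) atTop (𝓝 (s ^ 2)) := by
  have h := tendsto_tsum_boundaryProb hs hr hs0
  have e : ∫ k in -Real.pi..Real.pi, edgeWeight (s * Real.cos k) (r * Real.sin k) ^ 2 =
      ∫ k in -Real.pi..Real.pi, s ^ 2 := by
    refine intervalIntegral.integral_congr_ae ?_
    filter_upwards [ae_cos_ne_zero] with k hk _
    rw [edgeWeight_of_sq_eq_one hr1 hk, sq_abs]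
  rw [e, intervalIntegral.integral_const, smul_eq_mul] at h
  convert h using 2
  field_simp
  ring

theorem tendsto_boundaryProb_front (hs : s = Real.sin (α + β))
    (hr : r = Real.sin (α - β)) (hs0 : s ≠ 0) (hr1 : r ^ 2 = 1) {τ : ℤ}
    (hτ : (τ : ℝ) = Real.sign s * r) (j : ℤ) :
    Tendsto (fun n : ℕ => boundaryProb α β n (τ * (n - j))) atTop
      (𝓝 (s ^ 2 * if j = 0 then 1 else 0)) := by
  have hτ0 : τ ≠ 0 := by
    rintro rfl
    have := sign_sq hs0
    have h2 : (Real.sign s * r) ^ 2 = 0 := by rw [← hτ]; simp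
    rw [mul_pow, this, hr1] at h2
    norm_num at h2
  have h := tendsto_coeff_sub_edge hs hr hs0 (fun n : ℕ => τ * (n - j))
  have e : ∀ n : ℕ, (2 * Real.pi : ℂ)⁻¹ * ∫ k in -Real.pi..Real.pi, edgeFourier s r n k *
      Complex.exp (-(((τ * (n - j) : ℤ) : ℂ) * k * Complex.I)) =
      (|s| * (-Real.sign s : ℝ) ^ n) * if j = 0 then 1 else 0 := by
    intro n
    have e1 : ∫ k in -Real.pi..Real.pi, edgeFourier s r n k *
        Complex.exp (-(((τ * (n - j) : ℤ) : ℂ) * k * Complex.I)) =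
        ∫ k in -Real.pi..Real.pi, (|s| * (-Real.sign s : ℝ) ^ n) *
          Complex.exp ((τ * j : ℤ) * k * Complex.I) := by
      refine intervalIntegral.integral_congr_ae ?_
      filter_upwards [ae_cos_ne_zero] with k hk _
      rw [edgeFourier_of_sq_eq_one hτ hs0 hr1 n hk, mul_assoc, ← Complex.exp_add]
      congr 2
      push_cast; ring
    have hpi : (Real.pi : ℂ) ≠ 0 := by exact_mod_cast Real.pi_ne_zero
    rw [e1, intervalIntegral.integral_const_mul, integral_exp_int_mul]
    by_cases hj : j = 0
    · simp only [hj, mul_zero, if_true]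
      field_simp
    · simp [hj, hτ0]
  simp only [e] at h
  have hn : ∀ n : ℕ, ‖((|s| * (-Real.sign s : ℝ) ^ n) * if j = 0 then 1 else 0 : ℂ)‖ =
      |s| * if j = 0 then 1 else 0 := by
    intro n
    have : |Real.sign s| = 1 := by
      rw [← sq_eq_sq₀ (abs_nonneg _) zero_le_one, sq_abs, sign_sq hs0, one_pow]
    rw [norm_mul, norm_mul, norm_pow, Complex.norm_real, Complex.norm_real, Real.norm_eq_abs,
      Real.norm_eq_abs, abs_abs, abs_neg, this, one_pow, mul_one]
    split_ifs <;> simp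
  have h2 : Tendsto (fun n : ℕ => ‖(boundaryPoly α β n).coeff (τ * (n - j))‖) atTop
      (𝓝 (|s| * if j = 0 then 1 else 0)) := by
    rw [tendsto_iff_norm_sub_tendsto_zero]
    refine squeeze_zero (fun n => norm_nonneg _) (fun n => ?_) (tendsto_norm_zero.comp h)
    rw [← hn n]
    exact abs_norm_sub_norm_le _ _
  have h3 := h2.pow 2
  simp only [boundaryProb_eq]
  convert h3 using 2
  split_ifs <;> simp

/-- Excludes y = 1, where the front lies exactly on the edge of the window |j| < ny. -/
theorem not_continuousAt_unitStep {c : ℝ} (hc : c ≠ 0) :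
    ¬ ContinuousAt (fun y : ℝ≥0 => c * unitStep ((y : ℝ) - 1)) 1 := by
  intro h
  have : (𝓝[<] (1 : ℝ≥0)).NeBot := nhdsLT_neBot_of_exists_lt ⟨0, zero_lt_one⟩
  have h1 := h.tendsto.mono_left (nhdsWithin_le_nhds (s := Set.Iio 1))
  have h2 : Tendsto (fun y : ℝ≥0 => c * unitStep ((y : ℝ) - 1)) (𝓝[<] 1) (𝓝 0) := by
    refine tendsto_const_nhds.congr' ?_
    filter_upwards [self_mem_nhdsWithin] with y hy
    have : ((y : ℝ)) < 1 := by exact_mod_cast hy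
    rw [unitStep, if_neg (by linarith), mul_zero]
  have h3 := tendsto_nhds_unique h1 h2
  simp [unitStep] at h3
  exact hc h3

theorem ballistic (hs : s = Real.sin (α + β)) (hr : r = Real.sin (α - β)) (hs0 : s ≠ 0)
    (hr1 : |r| = 1) :
    BallisticSpreading (boundaryProb α β) ∧
      (∀ y : ℝ,
        Tendsto (fun n : ℕ => ∑' j : {j : ℤ // (j : ℝ) / n ≤ y}, boundaryProb α β n j) atTop
          (𝓝 (s ^ 2 * unitStep (y - (SignType.sign (r * s) : ℝ))))) ∧
      (∀ y : ℝ,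
        (ENNReal.ofReal (s ^ 2) • Measure.dirac (SignType.sign (r * s) : ℝ)).real (Set.Iic y) =
          s ^ 2 * unitStep (y - (SignType.sign (r * s) : ℝ))) ∧
      ∀ j : ℤ,
        Tendsto (fun n : ℕ => boundaryProb α β n ((SignType.sign (r * s) : ℤ) * ((n : ℤ) - j))) atTop
          (𝓝 (s ^ 2 * if j = 0 then 1 else 0)) := by
  have hr2 : r ^ 2 = 1 := by rw [← sq_abs, hr1, one_pow]
  have hs1 : s ^ 2 ≤ 1 := hs ▸ Real.sin_sq_le_one _
  obtain ⟨τ, hτ, hτZ, hτR, hτ1⟩ : ∃ τ : ℤ, (τ : ℝ) = Real.sign s * r ∧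
      ((SignType.sign (r * s) : SignType) : ℤ) = τ ∧
      ((SignType.sign (r * s) : SignType) : ℝ) = τ ∧ (τ = 1 ∨ τ = -1) := by
    rcases abs_eq (zero_le_one) |>.1 hr1 with h | h <;> rcases hs0.lt_or_gt with h' | h' <;> rw [h]
    · exact ⟨-1, by simp [Real.sign_of_neg h'], by simp [sign_neg h'], by simp [sign_neg h'],
        Or.inr rfl⟩
    · exact ⟨1, by simp [Real.sign_of_pos h'], by simp [sign_pos h'], by simp [sign_pos h'],
        Or.inl rfl⟩
    · have : 0 < -1 * s := by linarith
      exact ⟨1, by simp [Real.sign_of_neg h'], by rw [sign_pos this]; simp,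
        by rw [sign_pos this]; simp, Or.inl rfl⟩
    · have : -1 * s < 0 := by linarith
      exact ⟨-1, by simp [Real.sign_of_pos h'], by rw [sign_neg this]; simp,
        by rw [sign_neg this]; simp, Or.inr rfl⟩
  rw [hτZ, hτR]
  have htot := tendsto_tsum_boundaryProb_of_sq_eq_one hs hr hs0 hr2
  have hfront := tendsto_boundaryProb_front hs hr hs0 hr2 hτ
  have hpeak : Tendsto (fun n : ℕ => boundaryProb α β n (τ * n)) atTop (𝓝 (s ^ 2)) := by
    simpa using hfront 0
  have hnn := boundaryProb_nonneg α β
  have hsum := summable_boundaryProb α β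
  have habs : |(τ : ℝ)| = 1 := by rcases hτ1 with h | h <;> simp [h]
  refine ⟨⟨s ^ 2, ?_⟩, ?_, ?_, hfront⟩
  · refine ⟨fun y => ?_, fun y z hyz => ?_, fun h => ?_, fun c hc h => ?_, fun y hy => ?_⟩
    · unfold unitStep
      split_ifs
      · rw [mul_one]; exact ⟨sq_nonneg s, hs1⟩
      · simp
    · have : (y : ℝ) ≤ z := by exact_mod_cast hyz
      refine mul_le_mul_of_nonneg_left ?_ (sq_nonneg s)
      unfold unitStep
      split_ifs
      · exact le_rfl
      · linarith
      · exact zero_le_one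
      · exact le_rfl
    · have := congrFun h 1
      simp [unitStep] at this
      exact hs0 this
    · have := congrFun h 0
      norm_num [unitStep] at this
      exact hc this.symm
    · rcases lt_trichotomy (y : ℝ) 1 with h | h | h
      · rw [unitStep, if_neg (by linarith), mul_zero]
        refine tendsto_tsum_subtype_of_notMem (E := fun n : ℕ => {j : ℤ | |(j : ℝ)| < n * y})
          hnn hsum htot hpeak (Eventually.of_forall fun n => ?_)
        change ¬ |((τ * n : ℤ) : ℝ)| < n * y
        rw [not_lt]
        push_cast
        rw [abs_mul, habs, one_mul, Nat.abs_cast]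
        exact mul_le_of_le_one_right (Nat.cast_nonneg n) h.le
      · have : y = 1 := by exact_mod_cast h
        subst this
        exact absurd hy (not_continuousAt_unitStep (pow_ne_zero 2 hs0))
      · rw [unitStep, if_pos (by linarith), mul_one]
        refine tendsto_tsum_subtype_of_mem (E := fun n : ℕ => {j : ℤ | |(j : ℝ)| < n * y})
          hnn hsum htot hpeak ?_
        filter_upwards [eventually_gt_atTop 0] with n hn
        push_cast
        rw [abs_mul, habs, one_mul, Nat.abs_cast]
        exact lt_mul_of_one_lt_right (by exact_mod_cast hn) h
  · intro y
    have hdiv : ∀ᶠ n : ℕ in atTop, (((τ * n : ℤ)) : ℝ) / n = τ := by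
      filter_upwards [eventually_gt_atTop 0] with n hn
      have : (n : ℝ) ≠ 0 := by exact_mod_cast hn.ne'
      push_cast
      field_simp
    by_cases h : (τ : ℝ) ≤ y
    · rw [unitStep, if_pos (by linarith), mul_one]
      refine tendsto_tsum_subtype_of_mem (E := fun n : ℕ => {j : ℤ | (j : ℝ) / n ≤ y})
          hnn hsum htot hpeak ?_
      filter_upwards [hdiv] with n hn
      rwa [← hn] at h
    · rw [unitStep, if_neg (by linarith), mul_zero]
      refine tendsto_tsum_subtype_of_notMem (E := fun n : ℕ => {j : ℤ | (j : ℝ) / n ≤ y})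
          hnn hsum htot hpeak ?_
      filter_upwards [hdiv] with n hn
      rwa [← hn] at h
  · intro y
    rw [measureReal_ennreal_smul_apply, ENNReal.toReal_ofReal (sq_nonneg s), measureReal_def,
      Measure.dirac_apply' _ measurableSet_Iic]
    congr 1
    by_cases h : (τ : ℝ) ≤ y
    · simp [unitStep, h]
    · simp [unitStep, h]

end Ballistic


/-! ### The case r = 0. -/

section Localized

variable {α β s r : ℝ}

theorem tendsto_norm_sq_of_sub {u : ℕ → ℂ} {L : ℂ} (h : Tendsto (fun n => u n - L) atTop (𝓝 0)) :
    Tendsto (fun n => ‖u n‖ ^ 2) atTop (𝓝 (‖L‖ ^ 2)) := by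
  simpa using (h.add_const L).norm.pow 2

theorem edgePole_zero_right (e : ℝ) : edgePole e 0 = (-Real.sign e : ℝ) := by
  simp [edgePole]

theorem edgeWeight_zero_right (e : ℝ) : edgeWeight e 0 = |e| := by
  simp [edgeWeight]

/-- The pole is the real number -sgn(s cos k), whose even powers are 1. Where cos k = 0 the sign is
0 by convention, but there the weight vanishes. -/
theorem edgeFourier_zero_even (s : ℝ) (n : ℕ) (k : ℝ) :
    edgeFourier s 0 (2 * n) k = |s| * |Real.cos k| := by
  rw [edgeFourier, zero_mul, edgePole_zero_right, edgeWeight_zero_right, Complex.conj_ofReal,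
    pow_mul, ← Complex.ofReal_pow, ← Complex.ofReal_pow]
  by_cases h : s * Real.cos k = 0
  · rw [h, abs_zero, ← Complex.ofReal_mul |s|, ← abs_mul, h]; simp
  · rw [neg_sq, sign_sq h, one_pow, abs_mul]; simp

theorem edgeFourier_zero_odd (s : ℝ) (n : ℕ) (k : ℝ) :
    edgeFourier s 0 (2 * n + 1) k = -(s * Real.cos k : ℝ) := by
  rw [edgeFourier, zero_mul, edgePole_zero_right, edgeWeight_zero_right, Complex.conj_ofReal,
    pow_succ, pow_mul, ← Complex.ofReal_pow, ← Complex.ofReal_pow]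
  by_cases h : s * Real.cos k = 0
  · simp [h]
  · have : |s * Real.cos k| * -Real.sign (s * Real.cos k) = -(s * Real.cos k) := by
      rw [← sign_mul_eq_abs]
      linear_combination -(s * Real.cos k) * sign_sq h
    rw [neg_sq, sign_sq h, one_pow, Complex.ofReal_one, one_mul, ← Complex.ofReal_mul, this,
      Complex.ofReal_neg]

theorem exp_neg_int_mul_pi (j : ℤ) :
    Complex.exp (-(j * Real.pi * Complex.I)) = if Even j then 1 else -1 := by
  have h : Complex.exp (-(j * Real.pi * Complex.I)) = (-1) ^ (-j) := by
    rw [← Complex.exp_pi_mul_I, ← Complex.exp_int_mul]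
    congr 1; push_cast; ring
  rw [h]
  split_ifs with hj
  · exact hj.neg.neg_one_zpow
  · exact (Int.not_even_iff_odd.1 hj).neg.neg_one_zpow

theorem integral_cos_mul_exp {j : ℤ} (hj : Even j) :
    ((1 : ℂ) - j ^ 2) * ∫ k in -(Real.pi / 2)..Real.pi / 2,
      (Real.cos k : ℂ) * Complex.exp (-(j * k * Complex.I)) =
      2 * Complex.exp (-(j * (Real.pi / 2) * Complex.I)) := by
  -- An antiderivative of (1 - j²) cos k·exp(-ijk). Keeping the factor 1 - j² on the left avoids a
  -- division.
  have hd : ∀ k : ℝ, HasDerivAt (fun k : ℝ => Complex.exp (-(j * k * Complex.I)) *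
      ((Real.sin k : ℂ) - j * Complex.I * Real.cos k))
      ((1 - j ^ 2) * ((Real.cos k : ℂ) * Complex.exp (-(j * k * Complex.I)))) k := by
    intro k
    have h1 : HasDerivAt (fun k : ℝ => Complex.exp (-(j * k * Complex.I)))
        (Complex.exp (-(j * k * Complex.I)) * -(j * Complex.I)) k := by
      have h2 : HasDerivAt (fun k : ℝ => -(j * (k : ℂ) * Complex.I)) (-(j * Complex.I)) k := by
        refine (((Complex.ofRealCLM.hasDerivAt (x := k)).const_mul (j : ℂ)).mul_const
          Complex.I).neg.congr_deriv ?_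
        simp
      exact h2.cexp
    have h3 := (Real.hasDerivAt_sin k).ofReal_comp.sub
      ((Real.hasDerivAt_cos k).ofReal_comp.const_mul (j * Complex.I : ℂ))
    refine (h1.mul h3).congr_deriv ?_
    simp only [Pi.sub_apply]
    push_cast
    linear_combination (j : ℂ) ^ 2 * Complex.cos k * Complex.exp (-(j * k * Complex.I)) *
      Complex.I_sq
  rw [← intervalIntegral.integral_const_mul,
    intervalIntegral.integral_eq_sub_of_hasDerivAt (fun k _ => hd k)
      (Continuous.intervalIntegrable (by fun_prop) _ _)]
  have h4 : Complex.exp (-(j * ((-(Real.pi / 2) : ℝ) : ℂ) * Complex.I)) =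
      Complex.exp (-(j * (Real.pi / 2) * Complex.I)) := by
    have h5 := exp_neg_int_mul_pi j
    rw [if_pos hj] at h5
    have h6 : Complex.exp (-(j * (Real.pi / 2) * Complex.I)) =
        Complex.exp (-(j * ((-(Real.pi / 2) : ℝ) : ℂ) * Complex.I)) *
          Complex.exp (-(j * Real.pi * Complex.I)) := by
      rw [← Complex.exp_add]; congr 1; push_cast; ring
    rw [h6, h5, mul_one]
  rw [h4, Real.sin_neg, Real.cos_neg, Real.sin_pi_div_two, Real.cos_pi_div_two]
  push_cast
  ring

/-- A shift by π fixes |cos k| and multiplies the exponential by (-1)^j: the two half periods cancel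
for odd j and agree for even j. -/
theorem integral_abs_cos_mul_exp (j : ℤ) :
    ∫ k in -Real.pi..Real.pi, ((|Real.cos k| : ℝ) : ℂ) * Complex.exp (-(j * k * Complex.I)) =
      if Even j then 4 * Complex.exp (-(j * (Real.pi / 2) * Complex.I)) / (1 - j ^ 2) else 0 := by
  set f : ℝ → ℂ := fun k => ((|Real.cos k| : ℝ) : ℂ) * Complex.exp (-(j * k * Complex.I)) with hf
  have hfc : Continuous f := by
    simp only [hf]
    exact (Complex.continuous_ofReal.comp (by fun_prop)).mul (by fun_prop)
  have hshift : ∀ k, f (k + Real.pi) = (if Even j then 1 else -1) * f k := by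
    intro k
    have : Complex.exp (-(j * ((k + Real.pi : ℝ) : ℂ) * Complex.I)) =
        Complex.exp (-(j * k * Complex.I)) * Complex.exp (-(j * Real.pi * Complex.I)) := by
      rw [← Complex.exp_add]; congr 1; push_cast; ring
    simp only [hf]
    rw [Real.cos_add_pi, abs_neg, this, exp_neg_int_mul_pi]
    ring
  have hper : Function.Periodic f (2 * Real.pi) := by
    intro k
    rw [show k + 2 * Real.pi = k + Real.pi + Real.pi by ring, hshift, hshift]
    split_ifs <;> ring
  have h1 := hper.intervalIntegral_add_eq (-Real.pi) (-(Real.pi / 2))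
  rw [show -Real.pi + 2 * Real.pi = Real.pi by ring,
    show -(Real.pi / 2) + 2 * Real.pi = Real.pi / 2 + Real.pi by ring] at h1
  rw [h1, ← intervalIntegral.integral_add_adjacent_intervals
    (hfc.intervalIntegrable _ (Real.pi / 2)) (hfc.intervalIntegrable _ _)]
  have h2 : ∫ k in Real.pi / 2..Real.pi / 2 + Real.pi, f k =
      (if Even j then 1 else -1) * ∫ k in -(Real.pi / 2)..Real.pi / 2, f k := by
    rw [← intervalIntegral.integral_const_mul]
    simp only [← hshift]
    rw [intervalIntegral.integral_comp_add_right]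
    congr 1; ring
  rw [h2]
  split_ifs with hj
  · have h3 : ∫ k in -(Real.pi / 2)..Real.pi / 2, f k = ∫ k in -(Real.pi / 2)..Real.pi / 2,
        (Real.cos k : ℂ) * Complex.exp (-(j * k * Complex.I)) := by
      refine intervalIntegral.integral_congr fun k hk => ?_
      rw [Set.uIcc_of_le (by linarith [Real.pi_pos])] at hk
      simp only [hf]
      rw [abs_of_nonneg (Real.cos_nonneg_of_mem_Icc hk)]
    have h4 : (1 : ℂ) - j ^ 2 ≠ 0 := by
      intro h
      have h5 : j ^ 2 = 1 := by
        have : (j : ℂ) ^ 2 = 1 := by linear_combination -h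
        exact_mod_cast this
      rcases sq_eq_one_iff.1 h5 with h6 | h6 <;> rw [h6] at hj <;> revert hj <;> decide
    rw [h3, eq_div_iff h4]
    linear_combination 2 * integral_cos_mul_exp hj
  · ring

theorem tendsto_boundaryProb_even (hs : s = Real.sin (α + β)) (hr : Real.sin (α - β) = 0)
    (hs0 : s ≠ 0) (j : ℤ) :
    Tendsto (fun n : ℕ => boundaryProb α β (2 * n) j) atTop
      (𝓝 (if Even j then s ^ 2 / Real.pi ^ 2 * (4 / ((j : ℝ) ^ 2 - 1) ^ 2) else 0)) := by
  have h := (tendsto_coeff_sub_edge hs hr.symm hs0 (fun _ => j)).comp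
    (tendsto_id.const_mul_atTop' (two_pos (α := ℕ)))
  simp only [Function.comp_def, id_eq, edgeFourier_zero_even, mul_assoc,
    intervalIntegral.integral_const_mul] at h
  have e : ∀ k : ℝ, (j * (k * Complex.I) : ℂ) = j * k * Complex.I := fun k => by ring
  simp only [e, integral_abs_cos_mul_exp] at h
  have h2 := tendsto_norm_sq_of_sub h
  simp only [boundaryProb_eq]
  convert h2 using 2
  split_ifs with hj
  · have h3 : ‖Complex.exp (-(j * (Real.pi / 2) * Complex.I))‖ = 1 := by
      have := Complex.norm_exp_ofReal_mul_I (-(j * (Real.pi / 2)))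
      push_cast at this
      rw [← this]; congr 2; ring
    have h4 : ‖(1 : ℂ) - j ^ 2‖ = |1 - (j : ℝ) ^ 2| := by
      rw [← Real.norm_eq_abs, ← Complex.norm_real]; push_cast; rfl
    rw [norm_mul, norm_mul, norm_div, norm_mul, h3, h4, norm_inv, norm_mul, Complex.norm_real,
      Complex.norm_real, Real.norm_of_nonneg Real.pi_pos.le, Real.norm_eq_abs, abs_abs, mul_pow,
      mul_pow, div_pow, sq_abs, sq_abs]
    have h5 : (1 - (j : ℝ) ^ 2) ^ 2 = ((j : ℝ) ^ 2 - 1) ^ 2 := by ring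
    rw [h5]
    have h6 : ‖(2 : ℂ)‖ = 2 := by simp
    have h7 : ‖(4 : ℂ)‖ = 4 := by simp
    rw [h6, h7, inv_pow, mul_pow]
    ring
  · simp

theorem integral_cos_mul_exp_full (j : ℤ) :
    ∫ k in -Real.pi..Real.pi, (Real.cos k : ℂ) * Complex.exp (-(j * k * Complex.I)) =
      if j = 1 ∨ j = -1 then (Real.pi : ℂ) else 0 := by
  have e : ∀ k : ℝ, (Real.cos k : ℂ) * Complex.exp (-(j * k * Complex.I)) =
      2⁻¹ * Complex.exp ((1 - j : ℤ) * k * Complex.I) +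
        2⁻¹ * Complex.exp ((-1 - j : ℤ) * k * Complex.I) := by
    intro k
    rw [Complex.ofReal_cos, Complex.cos, add_div, add_mul, div_mul_eq_mul_div, div_mul_eq_mul_div,
      ← Complex.exp_add, ← Complex.exp_add, div_eq_inv_mul, div_eq_inv_mul]
    congr 3 <;> (push_cast; ring)
  simp only [e]
  rw [intervalIntegral.integral_add (Continuous.intervalIntegrable (by fun_prop) _ _)
    (Continuous.intervalIntegrable (by fun_prop) _ _), intervalIntegral.integral_const_mul,
    intervalIntegral.integral_const_mul, integral_exp_int_mul, integral_exp_int_mul]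
  by_cases h1 : j = 1
  · subst h1; norm_num; ring
  by_cases h2 : j = -1
  · subst h2; norm_num; ring
  · rw [if_neg (by omega), if_neg (by omega), if_neg (by simp [h1, h2])]; simp

theorem tendsto_boundaryProb_odd (hs : s = Real.sin (α + β)) (hr : Real.sin (α - β) = 0)
    (hs0 : s ≠ 0) (j : ℤ) :
    Tendsto (fun n : ℕ => boundaryProb α β (2 * n + 1) j) atTop
      (𝓝 (if j = 1 ∨ j = -1 then s ^ 2 / 4 else 0)) := by
  have h := (tendsto_coeff_sub_edge hs hr.symm hs0 (fun _ => j)).comp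
    ((tendsto_add_atTop_nat 1).comp (tendsto_id.const_mul_atTop' (two_pos (α := ℕ))))
  have e : ∀ k : ℝ, -((s * Real.cos k : ℝ) : ℂ) * Complex.exp (-(j * k * Complex.I)) =
      -s * ((Real.cos k : ℂ) * Complex.exp (-(j * k * Complex.I))) := fun k => by push_cast; ring
  simp only [Function.comp_def, id_eq, edgeFourier_zero_odd, e,
    intervalIntegral.integral_const_mul, integral_cos_mul_exp_full] at h
  have h2 := tendsto_norm_sq_of_sub h
  simp only [boundaryProb_eq]
  convert h2 using 2
  split_ifs with hj
  · have hpi : (Real.pi : ℂ) ≠ 0 := by exact_mod_cast Real.pi_ne_zero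
    have : (2 * Real.pi : ℂ)⁻¹ * (-s * Real.pi) = ((-(s / 2) : ℝ) : ℂ) := by
      push_cast; field_simp
    rw [this, Complex.norm_real, Real.norm_eq_abs, sq_abs]
    ring
  · simp

theorem localization (hs : s = Real.sin (α + β)) (hr : Real.sin (α - β) = 0) (hs0 : s ≠ 0) :
    Localization (boundaryProb α β) := by
  refine ⟨0, ?_⟩
  set c : ℝ := 4 * s ^ 2 / Real.pi ^ 2 with hc
  have hcpos : 0 < c := by positivity
  have h0 : Tendsto (fun n : ℕ => boundaryProb α β (2 * n) 0) atTop (𝓝 c) := by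
    convert tendsto_boundaryProb_even hs hr hs0 0 using 2
    simp [hc]; ring
  have h1 : Tendsto (fun n : ℕ => boundaryProb α β (2 * n + 1) 0) atTop (𝓝 0) := by
    simpa using tendsto_boundaryProb_odd hs hr hs0 0
  set A : ℕ → ℝ := fun T => (1 / (T : ℝ)) * ∑ n ∈ Finset.range T, boundaryProb α β n 0
  have hsum : ∀ m : ℕ, ∑ n ∈ Finset.range (2 * m), boundaryProb α β n 0 =
      ∑ i ∈ Finset.range m, (boundaryProb α β (2 * i) 0 + boundaryProb α β (2 * i + 1) 0) := by
    intro m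
    induction m with
    | zero => simp
    | succ m ih =>
      rw [Finset.sum_range_succ, ← ih, show 2 * (m + 1) = 2 * m + 1 + 1 by ring,
        Finset.sum_range_succ, Finset.sum_range_succ]
      ring
  have hA : Tendsto (fun m : ℕ => A (2 * m)) atTop (𝓝 (c / 2)) := by
    have h2 := ((h0.add h1).cesaro).const_mul (1 / 2)
    rw [add_zero] at h2
    convert h2 using 2 with m
    · simp only [A, hsum]
      push_cast
      rw [one_div_mul_eq_div, div_mul_eq_div_div]
      ring
    · ring
  -- For the limsup the even T suffice; there the averages tend to c/2, and any positive number
  -- below c/2 would serve in place of c/4.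
  have hfreq : ∃ᶠ T in atTop, c / 4 ≤ A T := by
    have h3 : ∀ᶠ m : ℕ in atTop, c / 4 ≤ A (2 * m) :=
      hA.eventually (le_mem_nhds (by linarith))
    exact (tendsto_id.const_mul_atTop' (two_pos (α := ℕ))).frequently h3.frequently
  have hbdd : IsBoundedUnder (· ≤ ·) atTop A := by
    refine isBoundedUnder_of ⟨1, fun T => ?_⟩
    have : ∑ n ∈ Finset.range T, boundaryProb α β n 0 ≤ T := by
      have := Finset.sum_le_card_nsmul (Finset.range T) (fun n => boundaryProb α β n 0) 1
        fun n _ => boundaryProb_le_one α β n 0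
      simpa using this
    simp only [A]
    rw [one_div_mul_eq_div]
    exact div_le_one_of_le₀ this (Nat.cast_nonneg T)
  have := le_limsup_of_frequently_le hfreq hbdd
  change 0 < limsup A atTop
  linarith

end Localized


/-! ### From momentum to velocity: the limit density. -/

section ChangeOfVariables

/-- The group velocity on the quarter period `(0, π / 2)`. -/
noncomputable def quarterVelocity (κ k : ℝ) : ℝ :=
  κ * Real.cos k / Real.sqrt (1 - (κ * Real.sin k) ^ 2)

variable {κ : ℝ}

theorem one_sub_sq_mul_sin_pos (hκ : κ ^ 2 < 1) (k : ℝ) : 0 < 1 - (κ * Real.sin k) ^ 2 := by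
  nlinarith [Real.sin_sq_le_one k, mul_nonneg (sq_nonneg κ) (sub_nonneg.2 (Real.sin_sq_le_one k))]

theorem quarterVelocity_sq (hκ : κ ^ 2 < 1) (k : ℝ) :
    quarterVelocity κ k ^ 2 = κ ^ 2 * Real.cos k ^ 2 / (1 - (κ * Real.sin k) ^ 2) := by
  rw [quarterVelocity, div_pow, Real.sq_sqrt (one_sub_sq_mul_sin_pos hκ k).le, mul_pow]

theorem hasDerivAt_quarterVelocity (hκ : κ ^ 2 < 1) (k : ℝ) :
    HasDerivAt (quarterVelocity κ) (-(κ * (1 - κ ^ 2) * Real.sin k /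
      ((1 - (κ * Real.sin k) ^ 2) * Real.sqrt (1 - (κ * Real.sin k) ^ 2)))) k := by
  have hD := one_sub_sq_mul_sin_pos hκ k
  have hq : 0 < Real.sqrt (1 - (κ * Real.sin k) ^ 2) := Real.sqrt_pos.2 hD
  have hq2 := Real.sq_sqrt hD.le
  have h1 : HasDerivAt (fun x => 1 - (κ * Real.sin x) ^ 2)
      (-(2 * (κ * Real.sin k) * (κ * Real.cos k))) k := by
    have := (((Real.hasDerivAt_sin k).const_mul κ).pow 2).const_sub 1
    simpa using this
  have h2 := ((Real.hasDerivAt_cos k).const_mul κ).div (h1.sqrt hD.ne') hq.ne'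
  refine h2.congr_deriv ?_
  rw [hq2]
  set q := Real.sqrt (1 - (κ * Real.sin k) ^ 2)
  rw [← hq2]
  have hcs := Real.sin_sq_add_cos_sq k
  field_simp
  linear_combination (-κ * Real.sin k) * hq2 + κ ^ 3 * Real.sin k * hcs

theorem injOn_quarterVelocity (hκ0 : κ ≠ 0) (hκ : κ ^ 2 < 1) :
    Set.InjOn (quarterVelocity κ) (Set.Ioo 0 (Real.pi / 2)) := by
  intro k hk l hl h
  have hk' : 0 < Real.cos k := Real.cos_pos_of_mem_Ioo ⟨by linarith [hk.1, hk.2], hk.2⟩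
  have hl' : 0 < Real.cos l := Real.cos_pos_of_mem_Ioo ⟨by linarith [hl.1, hl.2], hl.2⟩
  have h2 := congrArg (· ^ 2) h
  simp only [quarterVelocity_sq hκ] at h2
  rw [div_eq_div_iff (one_sub_sq_mul_sin_pos hκ k).ne' (one_sub_sq_mul_sin_pos hκ l).ne'] at h2
  have h3 : Real.cos k ^ 2 = Real.cos l ^ 2 := by
    apply mul_left_cancel₀ (mul_ne_zero (pow_ne_zero 2 hκ0) (sub_pos.2 hκ).ne')
    -- After cross-multiplication the mixed terms cos²k·cos²l cancel, leaving κ²(1 - κ²)(cos²k -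
    -- cos²l) = 0.
    linear_combination h2 + κ ^ 4 * Real.cos k ^ 2 * Real.sin_sq_add_cos_sq l -
      κ ^ 4 * Real.cos l ^ 2 * Real.sin_sq_add_cos_sq k
  have h4 : Real.cos k = Real.cos l := by
    rwa [sq_eq_sq₀ hk'.le hl'.le] at h3
  exact Real.injOn_cos ⟨hk.1.le, by linarith [hk.2, Real.pi_pos]⟩
    ⟨hl.1.le, by linarith [hl.2, Real.pi_pos]⟩ h4

theorem image_quarterVelocity (hκ0 : κ ≠ 0) (hκ : κ ^ 2 < 1) :
    quarterVelocity κ '' Set.Ioo 0 (Real.pi / 2) = {y : ℝ | 0 < y * κ ∧ y ^ 2 < κ ^ 2} := by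
  have hκ2 : 0 < κ ^ 2 := by positivity
  ext y
  constructor
  · rintro ⟨k, hk, rfl⟩
    have hc : 0 < Real.cos k := Real.cos_pos_of_mem_Ioo ⟨by linarith [hk.1, hk.2], hk.2⟩
    have hs : 0 < Real.sin k := Real.sin_pos_of_pos_of_lt_pi hk.1 (by linarith [hk.2, Real.pi_pos])
    have hD := one_sub_sq_mul_sin_pos hκ k
    have hq : 0 < Real.sqrt (1 - (κ * Real.sin k) ^ 2) := Real.sqrt_pos.2 hD
    refine ⟨?_, ?_⟩
    · have : quarterVelocity κ k * κ =
          κ ^ 2 * Real.cos k / Real.sqrt (1 - (κ * Real.sin k) ^ 2) := by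
        rw [quarterVelocity]; ring
      rw [this]; positivity
    · rw [quarterVelocity_sq hκ, div_lt_iff₀ hD]
      refine mul_lt_mul_of_pos_left ?_ hκ2
      nlinarith [Real.sin_sq_add_cos_sq k, mul_pos (sub_pos.2 hκ) (pow_pos hs 2)]
  · rintro ⟨h1, h2⟩
    have hy1 : 0 < 1 - y ^ 2 := by linarith
    have hk1 : 0 < 1 - κ ^ 2 := by linarith
    -- `q` is the value that √(1 - κ² sin²k) must take when the velocity is y: from y²q² = κ² cos²k
    -- = q² - (1 - κ²). Then `C` is the cosine sought.
    set q : ℝ := Real.sqrt ((1 - κ ^ 2) / (1 - y ^ 2)) with hq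
    have hq0 : 0 < q := Real.sqrt_pos.2 (div_pos hk1 hy1)
    have hq2 : q ^ 2 = (1 - κ ^ 2) / (1 - y ^ 2) := Real.sq_sqrt (div_pos hk1 hy1).le
    have hq2' : q ^ 2 * (1 - y ^ 2) = 1 - κ ^ 2 := by rw [hq2]; field_simp
    set C : ℝ := y / κ * q with hC
    have hC0 : 0 < C := by
      have : y / κ = y * κ / κ ^ 2 := by field_simp
      rw [hC, this]; positivity
    have hκC : κ * C = y * q := by rw [hC]; field_simp
    have hC2 : C ^ 2 < 1 := by
      have e1 : κ ^ 2 * C ^ 2 = y ^ 2 * q ^ 2 := by rw [← mul_pow, hκC, mul_pow]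
      have e2 : y ^ 2 * q ^ 2 = q ^ 2 - (1 - κ ^ 2) := by linarith
      have e3 : q ^ 2 < 1 := by rw [hq2, div_lt_one hy1]; linarith
      nlinarith
    have hC1 : C < 1 := by nlinarith
    refine ⟨Real.arccos C, ⟨Real.arccos_pos.2 hC1, Real.arccos_lt_pi_div_two.2 hC0⟩, ?_⟩
    have hcos : Real.cos (Real.arccos C) = C := Real.cos_arccos (by linarith) hC1.le
    have hD : 1 - (κ * Real.sin (Real.arccos C)) ^ 2 = q ^ 2 := by
      have := Real.sin_sq_add_cos_sq (Real.arccos C)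
      rw [hcos] at this
      linear_combination -κ ^ 2 * this + (κ * C + y * q) * hκC - hq2'
    rw [quarterVelocity, hcos, hD, Real.sqrt_sq hq0.le, hκC]
    field_simp

/-- Rewrites the support as exactly the image of (0, π/2) under the velocity. The passage from a
closed to an open half line costs nothing, because of the factor y². -/
theorem limitDensity_eq {s r : ℝ} (hs : s ≠ 0) (y : ℝ) :
    limitDensity s r y = Set.indicator
      {y : ℝ | 0 < y * (Real.sign s * r) ∧ y ^ 2 < (Real.sign s * r) ^ 2}
      (fun y => 2 * s ^ 2 / r ^ 2 * y ^ 2 *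
        (Real.sqrt (1 - r ^ 2) / (Real.pi * (1 - y ^ 2) * Real.sqrt (r ^ 2 - y ^ 2)))) y := by
  have hκ : (Real.sign s * r) ^ 2 = r ^ 2 := by rw [mul_pow, sign_sq hs, one_mul]
  have hsgn : ∀ z : ℝ, 0 < z * (Real.sign s * r) ↔ 0 < z * (s * r) := by
    intro z
    have h0 : 0 < |s| := abs_pos.2 hs
    have : z * (s * r) = |s| * (z * (Real.sign s * r)) := by
      rw [← sign_mul_eq_abs]
      linear_combination (-z * s * r) * sign_sq hs
    rw [this]
    exact ⟨fun h => mul_pos h0 h, fun h => pos_of_mul_pos_right h h0.le⟩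
  have hko : y ∈ Set.Ioo (-|r|) |r| ↔ y ^ 2 < r ^ 2 := by
    rw [Set.mem_Ioo, ← abs_lt, sq_lt_sq]
  rw [limitDensity, konno]
  set T : Set ℝ := {y : ℝ | 0 < y * (Real.sign s * r) ∧ y ^ 2 < (Real.sign s * r) ^ 2}
  by_cases hy : y ^ 2 < r ^ 2
  · rw [Set.indicator_of_mem (hko.2 hy)]
    by_cases hy2 : 0 < y * (Real.sign s * r)
    · have hT : y ∈ T := ⟨hy2, hκ ▸ hy⟩
      rw [Set.indicator_of_mem hT]
      rw [hsgn] at hy2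
      rw [sq_abs]
      split_ifs with h1 h2
      · have h0 : y ∈ Set.Ici (0 : ℝ) := (pos_of_mul_pos_left hy2 h1.le).le
        rw [Set.indicator_of_mem h0]; simp
      · have : y < 0 := by nlinarith
        have h0 : y ∈ Set.Iic (0 : ℝ) := this.le
        rw [Set.indicator_of_mem h0]; simp
      · have : s * r = 0 := le_antisymm (not_lt.1 h1) (not_lt.1 h2)
        rw [this, mul_zero] at hy2
        exact absurd hy2 (lt_irrefl _)
    · have hT : y ∉ T := fun h => hy2 h.1
      rw [Set.indicator_of_notMem hT]
      rw [hsgn, not_lt] at hy2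
      by_cases hy0 : y = 0
      · simp [hy0]
      split_ifs with h1 h2
      · rw [Set.indicator_of_notMem, mul_zero]
        intro h
        have h' : 0 ≤ y := h
        have := mul_pos (lt_of_le_of_ne h' (Ne.symm hy0)) h1
        linarith
      · rw [Set.indicator_of_notMem, mul_zero]
        intro h
        have h' : y ≤ 0 := h
        have := mul_pos_of_neg_of_neg (lt_of_le_of_ne h' hy0) h2
        linarith
      · rw [mul_zero]
  · have hT : y ∉ T := fun h => hy (hκ ▸ h.2)
    rw [Set.indicator_of_notMem (fun h => hy (hko.1 h)), Set.indicator_of_notMem hT]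
    ring

variable {s r : ℝ}

/-- The Jacobian cancels the singular square root of the Konno function. The constant 2/π is
4·(1/2π), as four quarter periods contribute equally. -/
theorem abs_deriv_mul_limitDensity (hs : s ≠ 0) (hr0 : r ≠ 0) (hr : r ^ 2 < 1) {k : ℝ}
    (hk : k ∈ Set.Ioo 0 (Real.pi / 2)) :
    |-((Real.sign s * r) * (1 - (Real.sign s * r) ^ 2) * Real.sin k /
      ((1 - (Real.sign s * r * Real.sin k) ^ 2) *
        Real.sqrt (1 - (Real.sign s * r * Real.sin k) ^ 2)))| *
      limitDensity s r (quarterVelocity (Real.sign s * r) k) =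
    2 / Real.pi * edgeWeight (s * Real.cos k) (r * Real.sin k) ^ 2 := by
  obtain ⟨κ, hκ⟩ : ∃ κ, κ = Real.sign s * r := ⟨_, rfl⟩
  rw [← hκ]
  have hκ2 : κ ^ 2 = r ^ 2 := by rw [hκ, mul_pow, sign_sq hs, one_mul]
  have hκ1 : κ ^ 2 < 1 := hκ2 ▸ hr
  have hκ0 : κ ≠ 0 := fun h => by
    rw [h] at hκ2; exact hr0 (by simpa using hκ2.symm)
  have hmem : quarterVelocity κ k ∈ {y : ℝ | 0 < y * κ ∧ y ^ 2 < κ ^ 2} := by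
    rw [← image_quarterVelocity hκ0 hκ1]; exact Set.mem_image_of_mem _ hk
  rw [limitDensity_eq hs, ← hκ, Set.indicator_of_mem hmem]
  have hsin : 0 < Real.sin k := Real.sin_pos_of_pos_of_lt_pi hk.1 (by linarith [hk.2, Real.pi_pos])
  have hD := one_sub_sq_mul_sin_pos hκ1 k
  have hD' : 1 - (r * Real.sin k) ^ 2 = 1 - (κ * Real.sin k) ^ 2 := by
    rw [mul_pow, mul_pow, hκ2]
  have hcs := Real.sin_sq_add_cos_sq k
  rw [edgeWeight, div_pow, sq_abs, hD', Real.sq_sqrt hD.le, quarterVelocity_sq hκ1]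
  obtain ⟨D, hDdef⟩ : ∃ D, D = 1 - (κ * Real.sin k) ^ 2 := ⟨_, rfl⟩
  rw [← hDdef] at hD ⊢
  have h1 : 1 - κ ^ 2 * Real.cos k ^ 2 / D = (1 - r ^ 2) / D := by
    rw [eq_div_iff hD.ne', sub_mul, div_mul_cancel₀ _ hD.ne', hDdef, ← hκ2]
    linear_combination -κ ^ 2 * hcs
  have h2 : r ^ 2 - κ ^ 2 * Real.cos k ^ 2 / D = (|κ| * Real.sqrt (1 - r ^ 2) * Real.sin k) ^ 2 / D := by
    rw [eq_div_iff hD.ne', sub_mul, div_mul_cancel₀ _ hD.ne', mul_pow, mul_pow, sq_abs,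
      Real.sq_sqrt (by linarith), hDdef, ← hκ2]
    linear_combination -κ ^ 2 * hcs
  have hp : 0 < 1 - r ^ 2 := by linarith
  have hsp : 0 < Real.sqrt (1 - r ^ 2) := Real.sqrt_pos.2 hp
  have hκa : 0 < |κ| := abs_pos.2 hκ0
  have hDs : 0 < Real.sqrt D := Real.sqrt_pos.2 hD
  rw [h1, h2, Real.sqrt_div (sq_nonneg _), Real.sqrt_sq (by positivity), abs_neg, abs_div, abs_mul,
    abs_mul, abs_of_pos hsin, abs_of_pos (mul_pos hD hDs), hκ2, abs_of_pos hp]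
  have hpi := Real.pi_pos
  field_simp

theorem integral_eq_four_mul {F : ℝ → ℂ} (hF : ∀ a b, IntervalIntegrable F volume a b)
    (hneg : ∀ k, F (-k) = F k) (hrefl : ∀ k, F (Real.pi - k) = F k) :
    ∫ k in -Real.pi..Real.pi, F k = 4 * ∫ k in Set.Ioo 0 (Real.pi / 2), F k := by
  have h1 : ∫ k in -Real.pi..0, F k = ∫ k in 0..Real.pi, F k := by
    have := intervalIntegral.integral_comp_neg (a := 0) (b := Real.pi) F
    simp only [hneg, neg_zero] at this
    exact this.symm
  have h2 : ∫ k in Real.pi / 2..Real.pi, F k = ∫ k in 0..Real.pi / 2, F k := by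
    have := intervalIntegral.integral_comp_sub_left (a := 0) (b := Real.pi / 2) F Real.pi
    simp only [hrefl, sub_zero] at this
    rw [this]
    congr 1; ring
  rw [← intervalIntegral.integral_add_adjacent_intervals (hF _ 0) (hF _ _), h1,
    ← intervalIntegral.integral_add_adjacent_intervals (hF 0 (Real.pi / 2)) (hF _ _), h2,
    intervalIntegral.integral_of_le (by linarith [Real.pi_pos]), integral_Ioc_eq_integral_Ioo]
  ring

theorem continuous_edgeWeight (hr : r ^ 2 < 1) :
    Continuous fun k => edgeWeight (s * Real.cos k) (r * Real.sin k) := by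
  unfold edgeWeight
  exact Continuous.div (by fun_prop) (by fun_prop)
    fun k => (Real.sqrt_pos.2 (one_sub_sq_mul_sin_pos hr k)).ne'

theorem continuous_edgeVelocity (hr : r ^ 2 < 1) : Continuous (edgeVelocity s r) := by
  unfold edgeVelocity
  exact Continuous.div (by fun_prop) (by fun_prop)
    fun k => (Real.sqrt_pos.2 (one_sub_sq_mul_sin_pos hr k)).ne'

theorem edgeVelocity_eq_quarterVelocity (hs : s ≠ 0) {k : ℝ} (hk : k ∈ Set.Ioo 0 (Real.pi / 2)) :
    edgeVelocity s r k = quarterVelocity (Real.sign s * r) k := by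
  rw [edgeVelocity, quarterVelocity, abs_of_pos (Real.cos_pos_of_mem_Ioo
    ⟨by linarith [hk.1, Real.pi_pos], hk.2⟩), mul_pow (Real.sign s * r), mul_pow (Real.sign s),
    sign_sq hs, one_mul, ← mul_pow]

theorem setIntegral_velocityRange (hs : s ≠ 0) (hr0 : r ≠ 0) (hr : r ^ 2 < 1) (h : ℝ → ℂ) :
    ∫ y, (limitDensity s r y : ℂ) * h y = ∫ k in Set.Ioo 0 (Real.pi / 2),
      2 / Real.pi * ((edgeWeight (s * Real.cos k) (r * Real.sin k) : ℂ) ^ 2 *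
        h (edgeVelocity s r k)) := by
  set κ := Real.sign s * r with hκ
  have hκ2 : κ ^ 2 = r ^ 2 := by rw [hκ, mul_pow, sign_sq hs, one_mul]
  have hκ1 : κ ^ 2 < 1 := hκ2 ▸ hr
  have hκ0 : κ ≠ 0 := fun h => by
    rw [h] at hκ2; exact hr0 (by simpa using hκ2.symm)
  have h1 : ∫ y, (limitDensity s r y : ℂ) * h y =
      ∫ y in {y : ℝ | 0 < y * κ ∧ y ^ 2 < κ ^ 2}, (limitDensity s r y : ℂ) * h y := by
    refine (setIntegral_eq_integral_of_forall_compl_eq_zero fun y hy => ?_).symm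
    rw [limitDensity_eq hs, ← hκ, Set.indicator_of_notMem hy]; simp
  rw [h1, ← image_quarterVelocity hκ0 hκ1, integral_image_eq_integral_abs_deriv_smul
    measurableSet_Ioo (fun k _ => (hasDerivAt_quarterVelocity hκ1 k).hasDerivWithinAt)
    (injOn_quarterVelocity hκ0 hκ1)]
  refine setIntegral_congr_fun measurableSet_Ioo fun k hk => ?_
  rw [edgeVelocity_eq_quarterVelocity hs hk, Complex.real_smul, ← mul_assoc, ← Complex.ofReal_mul,
    abs_deriv_mul_limitDensity hs hr0 hr hk]
  push_cast
  ring

/-- The density blows up at the end of its support where |y| = |r|, but its pull-back to the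
momentum is a continuous function. -/
theorem integrable_limitDensity (hs : s ≠ 0) (hr0 : r ≠ 0) (hr : r ^ 2 < 1) :
    Integrable (limitDensity s r) := by
  set κ := Real.sign s * r with hκ
  have hκ2 : κ ^ 2 = r ^ 2 := by rw [hκ, mul_pow, sign_sq hs, one_mul]
  have hκ1 : κ ^ 2 < 1 := hκ2 ▸ hr
  have hκ0 : κ ≠ 0 := fun h => by
    rw [h] at hκ2; exact hr0 (by simpa using hκ2.symm)
  have h1 : IntegrableOn (limitDensity s r) {y : ℝ | 0 < y * κ ∧ y ^ 2 < κ ^ 2} := by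
    rw [← image_quarterVelocity hκ0 hκ1, integrableOn_image_iff_integrableOn_abs_deriv_smul
      measurableSet_Ioo (fun k _ => (hasDerivAt_quarterVelocity hκ1 k).hasDerivWithinAt)
      (injOn_quarterVelocity hκ0 hκ1)]
    have hc : Continuous fun k => 2 / Real.pi *
        edgeWeight (s * Real.cos k) (r * Real.sin k) ^ 2 :=
      continuous_const.mul ((continuous_edgeWeight hr).pow 2)
    have h2 : IntegrableOn (fun k => 2 / Real.pi *
        edgeWeight (s * Real.cos k) (r * Real.sin k) ^ 2) (Set.Ioo 0 (Real.pi / 2)) :=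
      (hc.integrableOn_Icc).mono_set Set.Ioo_subset_Icc_self
    refine h2.congr_fun (fun k hk => ?_) measurableSet_Ioo
    exact (abs_deriv_mul_limitDensity hs hr0 hr hk).symm
  refine (integrableOn_iff_integrable_of_support_subset ?_).1 h1
  intro y hy
  by_contra hn
  apply hy
  rw [limitDensity_eq hs, ← hκ, Set.indicator_of_notMem hn]

theorem integral_edge_eq_limitDensity (hs : s ≠ 0) (hr0 : r ≠ 0) (hr : r ^ 2 < 1) {h : ℝ → ℂ}
    (hh : Continuous h) :
    (2 * Real.pi : ℂ)⁻¹ * ∫ k in -Real.pi..Real.pi,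
      (edgeWeight (s * Real.cos k) (r * Real.sin k) : ℂ) ^ 2 * h (edgeVelocity s r k) =
      ∫ y, (limitDensity s r y : ℂ) * h y := by
  have hpi : (Real.pi : ℂ) ≠ 0 := by exact_mod_cast Real.pi_ne_zero
  have hc : Continuous fun k => (edgeWeight (s * Real.cos k) (r * Real.sin k) : ℂ) ^ 2 *
      h (edgeVelocity s r k) :=
    ((Complex.continuous_ofReal.comp (continuous_edgeWeight hr)).pow 2).mul
      (hh.comp (continuous_edgeVelocity hr))
  rw [setIntegral_velocityRange hs hr0 hr, integral_const_mul, integral_eq_four_mul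
    (fun a b => hc.intervalIntegrable a b) (fun k => by simp [edgeWeight, edgeVelocity])
    (fun k => by simp [edgeWeight, edgeVelocity, Real.cos_pi_sub])]
  field_simp
  ring

theorem limitDensity_nonneg (hr : r ^ 2 < 1) (hs : s ≠ 0) (y : ℝ) : 0 ≤ limitDensity s r y := by
  rw [limitDensity_eq hs]
  refine Set.indicator_nonneg (fun y hy => ?_) y
  have h1 : (Real.sign s * r) ^ 2 = r ^ 2 := by rw [mul_pow, sign_sq hs, one_mul]
  have h2 : y ^ 2 < r ^ 2 := h1 ▸ hy.2
  have : 0 < 1 - y ^ 2 := by linarith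
  have := Real.pi_pos
  positivity

end ChangeOfVariables


/-! ### Weak convergence of rescaled point masses. -/

section WeakConvergence

theorem exists_probabilityMeasure_of_weights {S : Finset ℤ} {w : ℤ → ℝ} (hw : ∀ j, 0 ≤ w j)
    (hsum : ∑ j ∈ S, w j = 1) (x : ℤ → ℝ) :
    ∃ P : ProbabilityMeasure ℝ,
      (∀ t, charFun (P : Measure ℝ) t = ∑ j ∈ S, (w j : ℂ) * Complex.exp (t * x j * Complex.I)) ∧
      ∀ E, MeasurableSet E →
        (P : Measure ℝ).real E = ∑ j ∈ S, E.indicator (fun _ => w j) (x j) := by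
  set μ : Measure ℝ := ∑ j ∈ S, ENNReal.ofReal (w j) • Measure.dirac (x j) with hμ
  have hE : ∀ E, MeasurableSet E → μ E = ENNReal.ofReal (∑ j ∈ S, E.indicator (fun _ => w j) (x j)) := by
    intro E hE
    rw [ENNReal.ofReal_sum_of_nonneg fun j _ => Set.indicator_nonneg (fun _ _ => hw j) _, hμ,
      Measure.finsetSum_apply]
    refine Finset.sum_congr rfl fun j _ => ?_
    rw [Measure.smul_apply, Measure.dirac_apply' _ hE, smul_eq_mul]
    by_cases h : x j ∈ E <;> simp [h]
  have hprob : IsProbabilityMeasure μ := ⟨by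
    rw [hE _ MeasurableSet.univ]
    simp [hsum]⟩
  refine ⟨⟨μ, hprob⟩, fun t => ?_, fun E h => ?_⟩
  · rw [charFun_apply_real]
    change ∫ y, Complex.exp (t * y * Complex.I) ∂μ = _
    rw [hμ, integral_finsetSum_measure fun j _ => (integrable_dirac (by simp)).smul_measure (by simp)]
    refine Finset.sum_congr rfl fun j _ => ?_
    rw [integral_smul_measure, integral_dirac, ENNReal.toReal_ofReal (hw j), Complex.real_smul]
  · change μ.real E = _
    rw [measureReal_def, hE E h, ENNReal.toReal_ofReal
      (Finset.sum_nonneg fun j _ => Set.indicator_nonneg (fun _ _ => hw j) _)]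

/-- Lévy's continuity theorem and the portmanteau theorem for point masses on `ℤ / n`. -/
theorem tendsto_tsum_of_tendsto_charFun {f : ℕ → ℤ → ℝ} {S : ℕ → Finset ℤ} {g : ℝ → ℝ}
    (hf : ∀ n j, 0 ≤ f n j) (hS : ∀ n, ∀ j ∉ S n, f n j = 0)
    (hg0 : ∀ y, 0 ≤ g y) (hg : Integrable g) (hpos : 0 < ∫ y, g y)
    (hchar : ∀ t : ℝ, Tendsto (fun n : ℕ => ∑ j ∈ S n, (f n j : ℂ) *
      Complex.exp (t * ((j / n : ℝ) : ℂ) * Complex.I)) atTop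
      (𝓝 (∫ y, (g y : ℂ) * Complex.exp (t * y * Complex.I))))
    {E : Set ℝ} (hE : MeasurableSet E) (hfr : volume (frontier E) = 0) :
    Tendsto (fun n : ℕ => ∑' j : {j : ℤ // (j / n : ℝ) ∈ E}, f n j) atTop (𝓝 (∫ y in E, g y)) := by
  set m : ℝ := ∫ y, g y with hm
  set M : ℕ → ℝ := fun n => ∑ j ∈ S n, f n j with hM
  have hmass : Tendsto M atTop (𝓝 m) := by
    have h := (Complex.continuous_re.tendsto _).comp (hchar 0)
    simp only [Complex.ofReal_zero, zero_mul, Complex.exp_zero, mul_one, Function.comp_def] at h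
    rw [integral_complex_ofReal, Complex.ofReal_re] at h
    refine h.congr fun n => ?_
    rw [← Complex.ofReal_sum, Complex.ofReal_re]
  have hex : ∀ n : ℕ, ∃ P : ProbabilityMeasure ℝ, 0 < M n →
      (∀ t, charFun (P : Measure ℝ) t = ∑ j ∈ S n, ((f n j / M n : ℝ) : ℂ) *
        Complex.exp (t * ((j / n : ℝ) : ℂ) * Complex.I)) ∧
      ∀ E, MeasurableSet E →
        (P : Measure ℝ).real E = ∑ j ∈ S n, E.indicator (fun _ => f n j / M n) (j / n) := by
    intro n
    by_cases h : 0 < M n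
    · obtain ⟨P, hP⟩ := exists_probabilityMeasure_of_weights (S := S n) (w := fun j => f n j / M n)
        (fun j => div_nonneg (hf n j) h.le) (by rw [← Finset.sum_div]; exact div_self h.ne')
        (fun j => (j / n : ℝ))
      exact ⟨P, fun _ => hP⟩
    · exact ⟨⟨Measure.dirac 0, inferInstance⟩, fun h' => absurd h' h⟩
  choose P hP using hex
  have hMpos : ∀ᶠ n in atTop, 0 < M n := hmass.eventually (lt_mem_nhds hpos)
  set ρ : ℝ → ℝ≥0∞ := fun y => ENNReal.ofReal (g y / m)
  set μ : Measure ℝ := volume.withDensity ρ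
  have hρ : AEMeasurable ρ := (hg.aemeasurable.div_const m).ennreal_ofReal
  have hρreal : ∀ y, (ρ y).toReal = g y / m := fun y =>
    ENNReal.toReal_ofReal (div_nonneg (hg0 y) hpos.le)
  have hμE : ∀ E, MeasurableSet E → μ.real E = (∫ y in E, g y) / m := by
    intro E hE
    rw [measureReal_def, withDensity_apply _ hE, ← integral_toReal hρ.restrict
      (ae_of_all _ fun y => ENNReal.ofReal_lt_top)]
    simp only [hρreal]
    rw [integral_div]
  have hμ1 : IsProbabilityMeasure μ := ⟨by
    rw [withDensity_apply _ MeasurableSet.univ, Measure.restrict_univ,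
      ← ofReal_integral_eq_lintegral_ofReal (hg.div_const m)
        (ae_of_all _ fun y => div_nonneg (hg0 y) hpos.le), integral_div, div_self hpos.ne',
      ENNReal.ofReal_one]⟩
  obtain ⟨Q, hQ⟩ : ∃ Q : ProbabilityMeasure ℝ, (Q : Measure ℝ) = μ := ⟨⟨μ, hμ1⟩, rfl⟩
  have hweak : Tendsto P atTop (𝓝 Q) := by
    refine ProbabilityMeasure.tendsto_iff_tendsto_charFun.2 fun t => ?_
    have h1 : charFun (Q : Measure ℝ) t =
        (∫ y, (g y : ℂ) * Complex.exp (t * y * Complex.I)) / m := by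
      rw [hQ, charFun_apply_real]
      rw [integral_withDensity_eq_integral_toReal_smul₀ hρ
        (ae_of_all _ fun y => ENNReal.ofReal_lt_top), ← integral_div]
      refine integral_congr_ae (ae_of_all _ fun y => ?_)
      simp only [hρreal, Complex.real_smul]
      push_cast; ring
    rw [h1]
    have h2 := (hchar t).div ((Complex.continuous_ofReal.tendsto _).comp hmass)
      (by exact_mod_cast hpos.ne')
    refine h2.congr' ?_
    filter_upwards [hMpos] with n hn
    rw [(hP n hn).1, Pi.div_apply, Finset.sum_div]
    refine Finset.sum_congr rfl fun j _ => ?_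
    simp only [Function.comp_apply]
    push_cast; ring
  have hport := ProbabilityMeasure.tendsto_measure_of_null_frontier_of_tendsto' hweak (E := E)
    (by rw [hQ]; exact (withDensity_absolutelyContinuous volume ρ) hfr)
  rw [hQ] at hport
  have hreal := ((ENNReal.tendsto_toReal (measure_ne_top μ E)).comp hport).mul hmass
  have hlim : μ.real E * m = ∫ y in E, g y := by
    rw [hμE E hE, div_mul_cancel₀ _ hpos.ne']
  rw [← hlim]
  refine hreal.congr' ?_
  filter_upwards [hMpos] with n hn
  have h1 : ∑' j : {j : ℤ // (j / n : ℝ) ∈ E}, f n j =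
      ∑ j ∈ S n, E.indicator (fun _ => f n j) (j / n : ℝ) := by
    have h2 := tsum_subtype {j : ℤ | (j / n : ℝ) ∈ E} (f n)
    refine Eq.trans h2 ?_
    rw [tsum_eq_sum (s := S n) fun j hj => by
      by_cases h : j ∈ {j : ℤ | (j / n : ℝ) ∈ E}
      · rw [Set.indicator_of_mem h, hS n j hj]
      · rw [Set.indicator_of_notMem h]]
    refine Finset.sum_congr rfl fun j _ => ?_
    by_cases h : (j / n : ℝ) ∈ E
    · rw [Set.indicator_of_mem h]; exact Set.indicator_of_mem (s := {j : ℤ | (j / n : ℝ) ∈ E}) h _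
    · rw [Set.indicator_of_notMem h]
      exact Set.indicator_of_notMem (s := {j : ℤ | (j / n : ℝ) ∈ E}) h _
  rw [h1]
  simp only [Function.comp_apply]
  rw [← measureReal_def, (hP n hn).2 E hE, Finset.sum_mul]
  refine Finset.sum_congr rfl fun j _ => ?_
  by_cases h : (j / n : ℝ) ∈ E
  · simp only [Set.indicator_of_mem h]; rw [div_mul_cancel₀ _ hn.ne']
  · simp only [Set.indicator_of_notMem h]; ring

end WeakConvergence

/-! ### The case 0 < |r| < 1. -/

section LinearSpreading

variable {α β s r : ℝ}

theorem integral_limitDensity (hs : s ≠ 0) (hr0 : r ≠ 0) (hr : r ^ 2 < 1) :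
    ∫ y, limitDensity s r y = (2 * Real.pi)⁻¹ *
      ∫ k in -Real.pi..Real.pi, edgeWeight (s * Real.cos k) (r * Real.sin k) ^ 2 := by
  have h := integral_edge_eq_limitDensity hs hr0 hr (h := fun _ => 1) continuous_const
  simp only [mul_one] at h
  rw [integral_complex_ofReal] at h
  have e : ∫ k in -Real.pi..Real.pi, (edgeWeight (s * Real.cos k) (r * Real.sin k) : ℂ) ^ 2 =
      ((∫ k in -Real.pi..Real.pi, edgeWeight (s * Real.cos k) (r * Real.sin k) ^ 2 : ℝ) : ℂ) := by
    rw [← intervalIntegral.integral_ofReal]; push_cast; rfl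
  rw [e] at h
  exact_mod_cast h.symm

theorem integral_limitDensity_pos (hs : s ≠ 0) (hr0 : r ≠ 0) (hr : r ^ 2 < 1) :
    0 < ∫ y, limitDensity s r y := by
  rw [integral_limitDensity hs hr0 hr]
  refine mul_pos (by have := Real.pi_pos; positivity) ?_
  -- The denominator 1 - v² of w² is at most 1.
  have h : ∫ k in -Real.pi..Real.pi, s ^ 2 * Real.cos k ^ 2 ≤
      ∫ k in -Real.pi..Real.pi, edgeWeight (s * Real.cos k) (r * Real.sin k) ^ 2 := by
    refine intervalIntegral.integral_mono_on (by linarith [Real.pi_pos])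
      (Continuous.intervalIntegrable (by fun_prop) _ _)
      (((continuous_edgeWeight hr).pow 2).intervalIntegrable _ _) fun k _ => ?_
    have hD := one_sub_sq_mul_sin_pos hr k
    rw [edgeWeight, div_pow, sq_abs, Real.sq_sqrt hD.le, mul_pow]
    exact le_div_self (by positivity) hD (by linarith [sq_nonneg (r * Real.sin k)])
  refine lt_of_lt_of_le ?_ h
  rw [intervalIntegral.integral_const_mul, integral_cos_sq]
  have := Real.pi_pos
  have : 0 < s ^ 2 := by positivity
  simp only [Real.sin_pi, Real.sin_neg, mul_zero, neg_zero, sub_zero, zero_add, sub_neg_eq_add]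
  positivity

theorem integral_limitDensity_le_one (hs : s ≠ 0) (hs1 : s ^ 2 ≤ 1) (hr0 : r ≠ 0)
    (hr : r ^ 2 < 1) : ∫ y, limitDensity s r y ≤ 1 := by
  rw [integral_limitDensity hs hr0 hr]
  have h : ∫ k in -Real.pi..Real.pi, edgeWeight (s * Real.cos k) (r * Real.sin k) ^ 2 ≤
      ∫ k in -Real.pi..Real.pi, (1 : ℝ) := by
    refine intervalIntegral.integral_mono_on (by linarith [Real.pi_pos])
      (((continuous_edgeWeight hr).pow 2).intervalIntegrable _ _) (by simp) fun k _ => ?_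
    exact pow_le_one₀ (edgeWeight_nonneg _ _)
      (edgeWeight_le_one (sq_cos_add_sq_sin_le hs1 hr.le k))
  rw [intervalIntegral.integral_const, smul_eq_mul, mul_one] at h
  rw [inv_mul_le_iff₀ (by have := Real.pi_pos; positivity)]
  linarith

theorem tendsto_tsum_boundaryProb_mem (hs : s = Real.sin (α + β)) (hr : r = Real.sin (α - β))
    (hs0 : s ≠ 0) (hr0 : r ≠ 0) (hr1 : r ^ 2 < 1) {E : Set ℝ} (hE : MeasurableSet E)
    (hfr : volume (frontier E) = 0) :
    Tendsto (fun n : ℕ => ∑' j : {j : ℤ // (j / n : ℝ) ∈ E}, boundaryProb α β n j) atTop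
      (𝓝 (∫ y in E, limitDensity s r y)) := by
  refine tendsto_tsum_of_tendsto_charFun (S := fun n => (boundaryPoly α β n).coeff.support)
    (boundaryProb_nonneg α β) (fun n j hj => ?_) (limitDensity_nonneg hr1 hs0)
    (integrable_limitDensity hs0 hr0 hr1) (integral_limitDensity_pos hs0 hr0 hr1) (fun t => ?_)
    hE hfr
  · rw [boundaryProb_eq, Finsupp.notMem_support_iff.1 hj]; simp
  · have h := tendsto_tsum_boundaryProb_mul_exp hs hr hs0 t
    have h2 := integral_edge_eq_limitDensity hs0 hr0 hr1
      (h := fun y => Complex.exp (t * y * Complex.I)) (by fun_prop)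
    rw [h2] at h
    refine h.congr fun n => ?_
    rw [tsum_boundaryProb_mul]
    refine Finset.sum_congr rfl fun j _ => ?_
    congr 2
    push_cast
    ring

theorem linearSpreading (hs : s = Real.sin (α + β)) (hr : r = Real.sin (α - β))
    (hs0 : s ≠ 0) (h0 : 0 < |r|) (h1 : |r| < 1) :
    ContinuouslyLinearSpreading (boundaryProb α β) ∧
      Integrable (limitDensity s r) ∧
      ∀ a b : ℝ, a < b →
        Tendsto (fun n : ℕ => ∑' j : {j : ℤ // a ≤ (j : ℝ) / n ∧ (j : ℝ) / n ≤ b},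
          boundaryProb α β n j) atTop (𝓝 (∫ y in a..b, limitDensity s r y)) := by
  have hr0 : r ≠ 0 := abs_pos.1 h0
  have hr1 : r ^ 2 < 1 := (sq_lt_one_iff_abs_lt_one r).2 h1
  have hs1 : s ^ 2 ≤ 1 := hs ▸ Real.sin_sq_le_one _
  have hint := integrable_limitDensity hs0 hr0 hr1
  have hnn := limitDensity_nonneg hr1 hs0
  have hpair : ∀ a b : ℝ, volume ({a, b} : Set ℝ) = 0 := fun a b =>
    (Set.toFinite {a, b}).measure_zero volume
  refine ⟨⟨fun y => ∫ x in -(y : ℝ)..y, limitDensity s r x, ⟨fun y => ?_, fun y z hyz => ?_,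
    fun h => ?_, fun c hc h => ?_, fun y _ => ?_⟩, ?_⟩, hint, fun a b hab => ?_⟩
  · have hy : -(y : ℝ) ≤ y := by linarith [y.2]
    refine ⟨intervalIntegral.integral_nonneg hy fun x _ => hnn x, ?_⟩
    rw [intervalIntegral.integral_of_le hy]
    exact (setIntegral_le_integral hint (ae_of_all _ hnn)).trans
      (integral_limitDensity_le_one hs0 hs1 hr0 hr1)
  · have hyz' : (y : ℝ) ≤ z := by exact_mod_cast hyz
    exact intervalIntegral.integral_mono_interval (by linarith) (by linarith [y.2]) hyz'
      (ae_of_all _ hnn) hint.intervalIntegrable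
  · have h2 := congrFun h 1
    simp only [NNReal.coe_one, Pi.zero_apply] at h2
    -- The support lies in (-1, 1), so F(1) is the whole mass, which is positive.
    rw [intervalIntegral.integral_of_le (by norm_num), integral_Ioc_eq_integral_Ioo,
      setIntegral_eq_integral_of_forall_compl_eq_zero] at h2
    · exact (integral_limitDensity_pos hs0 hr0 hr1).ne' h2
    · intro x hx
      rw [limitDensity_eq hs0]
      refine Set.indicator_of_notMem (fun hm => hx ?_) _
      have h3 : x ^ 2 < 1 := by
        refine hm.2.trans ?_
        rwa [mul_pow, sign_sq hs0, one_mul]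
      exact abs_lt.1 ((sq_lt_one_iff_abs_lt_one x).1 h3)
  -- At 0 the interval is degenerate and F(0) = 0, whereas the step function already equals c there.
  · have h2 := congrFun h 0
    simp [unitStep] at h2
    exact hc h2.symm
  -- For y = 0 the window is empty; for y > 0 it is an open interval whose frontier consists of two
  -- points.
  · rcases eq_or_lt_of_le y.2 with hy | hy
    · have hy0 : (y : ℝ) = 0 := hy.symm
      simp only [hy0, neg_zero, intervalIntegral.integral_same]
      refine tendsto_const_nhds.congr fun n => ?_
      have : IsEmpty {j : ℤ // |(j : ℝ)| < n * (y : ℝ)} := ⟨by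
        rintro ⟨j, hj⟩
        rw [hy0, mul_zero] at hj
        exact (abs_nonneg _).not_gt hj⟩
      rw [tsum_empty]
    · have hy' : -(y : ℝ) < y := by linarith [show (0 : ℝ) < y from hy]
      have h2 := tendsto_tsum_boundaryProb_mem hs hr hs0 hr0 hr1 (E := Set.Ioo (-(y : ℝ)) y)
        measurableSet_Ioo (by rw [frontier_Ioo hy']; exact hpair _ _)
      rw [intervalIntegral.integral_of_le hy'.le, integral_Ioc_eq_integral_Ioo]
      refine h2.congr' ?_
      filter_upwards [eventually_gt_atTop 0] with n hn
      have hn' : (0 : ℝ) < n := by exact_mod_cast hn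
      have e : {j : ℤ | (j / n : ℝ) ∈ Set.Ioo (-(y : ℝ)) y} = {j : ℤ | |(j : ℝ)| < n * y} := by
        ext j
        change (j / n : ℝ) ∈ Set.Ioo (-(y : ℝ)) y ↔ |(j : ℝ)| < n * y
        rw [Set.mem_Ioo, ← abs_lt, abs_div, abs_of_pos hn', div_lt_iff₀ hn', mul_comm]
      exact tsum_congr_set_coe (boundaryProb α β n) e
  · have hc := intervalIntegral.continuous_primitive
      (fun a b => hint.intervalIntegrable (a := a) (b := b)) 0
    have e : (fun y : ℝ≥0 => ∫ x in -(y : ℝ)..y, limitDensity s r x) = fun y : ℝ≥0 =>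
        (∫ x in (0 : ℝ)..y, limitDensity s r x) - ∫ x in (0 : ℝ)..-(y : ℝ), limitDensity s r x := by
      ext y
      exact (intervalIntegral.integral_interval_sub_left hint.intervalIntegrable
        hint.intervalIntegrable).symm
    rw [e]
    exact (hc.comp NNReal.continuous_coe).sub (hc.comp NNReal.continuous_coe.neg)
  · have h2 := tendsto_tsum_boundaryProb_mem hs hr hs0 hr0 hr1 (E := Set.Icc a b)
        measurableSet_Icc (by rw [frontier_Icc hab.le]; exact hpair _ _)
    rw [intervalIntegral.integral_of_le hab.le, ← integral_Icc_eq_integral_Ioc]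
    exact h2

end LinearSpreading

end AEWalk

theorem theorem3 (α β : ℝ) (hα : α ∈ Set.Ico 0 (2 * Real.pi)) (hβ : β ∈ Set.Ico 0 (2 * Real.pi))
    (s r : ℝ) (hs : s = Real.sin (α + β)) (hr : r = Real.sin (α - β)) (hs0 : s ≠ 0)
    (ν : ℕ → ℤ → ℝ) (hν : ν = AEWalk.boundaryProb α β) :
    (0 < |r| → |r| < 1 →
      AEWalk.ContinuouslyLinearSpreading ν ∧
      Integrable (AEWalk.limitDensity s r) ∧
      ∀ a b : ℝ, a < b →
        Tendsto (fun n : ℕ => ∑' j : {j : ℤ // a ≤ (j : ℝ) / n ∧ (j : ℝ) / n ≤ b}, ν n j) atTop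
          (𝓝 (∫ y in a..b, AEWalk.limitDensity s r y))) ∧
    (|r| = 1 →
      AEWalk.BallisticSpreading ν ∧
      (∀ y : ℝ,
        Tendsto (fun n : ℕ => ∑' j : {j : ℤ // (j : ℝ) / n ≤ y}, ν n j) atTop
          (𝓝 (s ^ 2 * AEWalk.unitStep (y - (SignType.sign (r * s) : ℝ))))) ∧
      (∀ y : ℝ,
        (ENNReal.ofReal (s ^ 2) • Measure.dirac (SignType.sign (r * s) : ℝ)).real (Set.Iic y) =
          s ^ 2 * AEWalk.unitStep (y - (SignType.sign (r * s) : ℝ))) ∧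
      ∀ j : ℤ,
        Tendsto (fun n : ℕ => ν n ((SignType.sign (r * s) : ℤ) * ((n : ℤ) - j))) atTop
          (𝓝 (s ^ 2 * if j = 0 then 1 else 0))) ∧
    (r = 0 →
      AEWalk.Localization ν ∧
      (∀ j : ℤ, Tendsto (fun n : ℕ => ν (2 * n) j) atTop
        (𝓝 (if Even j then s ^ 2 / Real.pi ^ 2 * (4 / ((j : ℝ) ^ 2 - 1) ^ 2) else 0))) ∧
      ∀ j : ℤ, Tendsto (fun n : ℕ => ν (2 * n + 1) j) atTop
        (𝓝 (if j = 1 ∨ j = -1 then s ^ 2 / 4 else 0))) := by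
  subst hν
  refine ⟨AEWalk.linearSpreading hs hr hs0, AEWalk.ballistic hs hr hs0, fun h => ?_⟩
  rw [hr] at h
  exact ⟨AEWalk.localization hs h hs0, AEWalk.tendsto_boundaryProb_even hs h hs0,
    AEWalk.tendsto_boundaryProb_odd hs h hs0⟩
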